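/- **Theorem 1.1.** Let $d$ be a natural number. Write $\langle z,w\rangle=\sum_{i} z_i\overline{w_i}$ on $\mathbb C^d$ and let $\mathcal F^2(\mathbb C^d)$ be the Fock space, i.e. the Hilbert space of all entire functions $f$ on $\mathbb C^d$ with $\frac1{\pi^d}\int_{\mathbb C^d}|f(z)|^2e^{-|z|^2}\,dV(z)<\infty$, where $dV$ is Lebesgue measure, with the inner product $\langle f,g\rangle=\frac1{\pi^d}\int_{\mathbb C^d} f(z)\overline{g(z)}e^{-|z|^2}\,dV(z)$. Let $\psi$ be an entire function on $\mathbb C^d$ that is not identically zero and let $\varphi:\mathbb C^d\to\mathbb C^d$ be holomorphic. The maximal weighted composition operator $C_{\psi,\varphi,\max}$ is the operator $f\mapsto\psi\cdot(f\circ\varphi)$ with domain $\{f\in\mathcal F^2(\mathbb C^d):\psi\cdot(f\circ\varphi)\in\mathcal F^2(\mathbb C^d)\}$. A weighted composition operator $C_{\psi,\varphi}$ with symbols $\psi,\varphi$ is any restriction of $C_{\psi,\varphi,\max}$ to a linear subspace of its domain. A linear operator $S$ with domain in $\mathcal F^2(\mathbb C^d)$ is called selfadjoint (resp. skew-selfadjoint)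 if it is densely defined and $S=S^*$ (resp. $S=-S^*$), with equality of domains. Consider the condition $(*)$ there are a complex $d\times d$ matrix $Q$ with $Q=Q^*$, a vector $q\in\mathbb C^d$ and a number $\theta\in\mathbb R$ (resp. $\theta\in i\mathbb R$) such that $\psi(z)=\theta e^{\langle z,q\rangle}$ and $\varphi(z)=Qz+q$ for all $z\in\mathbb C^d$. (a) The operator $C_{\psi,\varphi,\max}$ is selfadjoint (resp. skew-selfadjoint) if and only if $(*)$ holds. (b) A weighted composition operator $C_{\psi,\varphi}$ with symbols $\psi,\varphi$ is selfadjoint (resp. skew-selfadjoint) if and only if $C_{\psi,\varphi}=C_{\psi,\varphi,\max}$ and $(*)$ holds. -/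

import Mathlib

open MeasureTheory Filter Topology
open scoped LinearPMap

/-- `f` is square integrable against the Gaussian weight `exp (-|z|^2)` on `ℂ^d`. -/
def GaussSqIntegrable {d : ℕ} (f : EuclideanSpace ℂ (Fin d) → ℂ) : Prop :=
  Integrable (fun z => ‖f z‖ ^ 2 * Real.exp (-‖z‖ ^ 2))

theorem gaussSqIntegrable_add {d : ℕ} {f g : EuclideanSpace ℂ (Fin d) → ℂ}
    (hf : Continuous f) (hg : Continuous g)
    (hf2 : GaussSqIntegrable f) (hg2 : GaussSqIntegrable g) :
    GaussSqIntegrable (f + g) := by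
  unfold GaussSqIntegrable at *
  refine ((hf2.const_mul 2).add (hg2.const_mul 2)).mono' (by
    apply Continuous.aestronglyMeasurable
    simp only [Pi.add_apply]
    fun_prop) (Eventually.of_forall fun z => ?_)
  have h1 : ‖f z + g z‖ ≤ ‖f z‖ + ‖g z‖ := norm_add_le _ _
  have h2 : ‖f z + g z‖ ^ 2 ≤ 2 * ‖f z‖ ^ 2 + 2 * ‖g z‖ ^ 2 := by
    have h3 : ‖f z + g z‖ ^ 2 ≤ (‖f z‖ + ‖g z‖) ^ 2 := by gcongr
    nlinarith [sq_nonneg (‖f z‖ - ‖g z‖)]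
  simp only [Pi.add_apply]
  rw [Real.norm_of_nonneg (by positivity)]
  calc _ ≤ (2 * ‖f z‖ ^ 2 + 2 * ‖g z‖ ^ 2) * Real.exp (-‖z‖ ^ 2) := by gcongr
    _ = _ := by ring

/-- The entire functions `f` on `ℂ^d` with `∫ |f(z)|^2 exp (-|z|^2) dV(z) < ∞`. -/
def fockSubmodule (d : ℕ) : Submodule ℂ (EuclideanSpace ℂ (Fin d) → ℂ) where
  carrier := {f | Differentiable ℂ f ∧ GaussSqIntegrable f}
  zero_mem' := ⟨differentiable_const 0, by simp [GaussSqIntegrable]⟩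
  add_mem' := fun hf hg =>
    ⟨hf.1.add hg.1, gaussSqIntegrable_add hf.1.continuous hg.1.continuous hf.2 hg.2⟩
  smul_mem' := fun c f hf => ⟨hf.1.const_smul c, by
    have h := hf.2.const_mul (‖c‖ ^ 2)
    refine h.congr (Eventually.of_forall fun z => ?_)
    simp only [Pi.smul_apply, norm_smul]
    ring⟩

/-- The Fock space of `ℂ^d`. -/
def FockSpace (d : ℕ) : Type := fockSubmodule d

noncomputable section

namespace FockSpace

variable {d : ℕ}

instance : AddCommGroup (FockSpace d) := inferInstanceAs (AddCommGroup (fockSubmodule d))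

instance : Module ℂ (FockSpace d) := inferInstanceAs (Module ℂ (fockSubmodule d))

instance : FunLike (FockSpace d) (EuclideanSpace ℂ (Fin d)) ℂ where
  coe f := (show fockSubmodule d from f).1
  coe_injective := Subtype.coe_injective

/-- The element of the Fock space given by a function in `fockSubmodule d`. -/
def mk (f : EuclideanSpace ℂ (Fin d) → ℂ) (hf : f ∈ fockSubmodule d) : FockSpace d :=
  show fockSubmodule d from ⟨f, hf⟩

@[simp] theorem mk_apply (f : EuclideanSpace ℂ (Fin d) → ℂ) (hf : f ∈ fockSubmodule d) (z) :
    mk f hf z = f z := rfl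

theorem coe_mem (f : FockSpace d) : ⇑f ∈ fockSubmodule d :=
  (show fockSubmodule d from f).2

theorem coe_ext {f g : FockSpace d} (h : ∀ z, f z = g z) : f = g := DFunLike.ext _ _ h

@[simp] theorem add_apply (f g : FockSpace d) (z) : (f + g) z = f z + g z := rfl

@[simp] theorem sub_apply (f g : FockSpace d) (z) : (f - g) z = f z - g z := rfl

@[simp] theorem smul_apply (c : ℂ) (f : FockSpace d) (z) : (c • f) z = c * f z := rfl

@[simp] theorem zero_apply (z) : (0 : FockSpace d) z = 0 := rfl

theorem differentiable (f : FockSpace d) : Differentiable ℂ f := f.coe_mem.1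

theorem continuous (f : FockSpace d) : Continuous f := f.coe_mem.1.continuous

theorem integrable_sq (f : FockSpace d) :
    Integrable (fun z => ‖f z‖ ^ 2 * Real.exp (-‖z‖ ^ 2)) := f.coe_mem.2

theorem integrable_mul (f g : FockSpace d) :
    Integrable (fun z => starRingEnd ℂ (f z) * g z * (Real.exp (-‖z‖ ^ 2) : ℂ)) := by
  have hf := f.continuous
  have hg := g.continuous
  refine (f.integrable_sq.add g.integrable_sq).mono' (by
    apply Continuous.aestronglyMeasurable
    fun_prop) (Eventually.of_forall fun z => ?_)
  have h1 : ‖f z‖ * ‖g z‖ ≤ ‖f z‖ ^ 2 + ‖g z‖ ^ 2 := by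
    nlinarith [sq_nonneg (‖f z‖ - ‖g z‖), sq_nonneg (‖f z‖), sq_nonneg (‖g z‖)]
  rw [norm_mul, norm_mul, RCLike.norm_conj, Complex.norm_real,
    Real.norm_of_nonneg (Real.exp_nonneg _), Pi.add_apply, ← add_mul]
  gcongr

/-- `⟨f, g⟩ = π^(-d) ∫ conj (f(z)) g(z) exp (-|z|^2) dV(z)`; as everywhere in Mathlib the inner
product is conjugate-linear in its first argument. -/
instance : Inner ℂ (FockSpace d) :=
  ⟨fun f g => ((Real.pi : ℂ) ^ d)⁻¹ *
    ∫ z, starRingEnd ℂ (f z) * g z * (Real.exp (-‖z‖ ^ 2) : ℂ)⟩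

theorem inner_def (f g : FockSpace d) :
    inner ℂ f g = ((Real.pi : ℂ) ^ d)⁻¹ *
      ∫ z, starRingEnd ℂ (f z) * g z * (Real.exp (-‖z‖ ^ 2) : ℂ) := rfl

theorem inner_self_eq (f : FockSpace d) :
    inner ℂ f f = (((Real.pi ^ d)⁻¹ * ∫ z, ‖f z‖ ^ 2 * Real.exp (-‖z‖ ^ 2) : ℝ) : ℂ) := by
  rw [inner_def]
  rw [Complex.ofReal_mul, ← integral_complex_ofReal]
  congr 1
  · push_cast
    rfl
  · congr 1
    funext z
    rw [mul_comm (starRingEnd ℂ (f z)), Complex.mul_conj, Complex.normSq_eq_norm_sq]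
    push_cast
    rfl

/-- The inner product axioms. -/
@[reducible] def innerCore (d : ℕ) : InnerProductSpace.Core ℂ (FockSpace d) where
  inner := fun f g => inner ℂ f g
  conj_inner_symm f g := by
    rw [inner_def, inner_def, map_mul, ← integral_conj]
    congr 1
    · simp
    · congr 1
      funext z
      simp only [map_mul, Complex.conj_conj, Complex.conj_ofReal]
      ring
  re_inner_nonneg f := by
    rw [inner_self_eq]
    rw [RCLike.re_to_complex, Complex.ofReal_re]
    have := Real.pi_pos
    exact mul_nonneg (by positivity) (integral_nonneg fun z => by positivity)
  add_left f g h := by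
    simp only [inner_def]
    rw [← mul_add, ← integral_add (integrable_mul f h) (integrable_mul g h)]
    congr 2
    funext z
    simp only [add_apply, map_add]
    ring
  smul_left f g c := by
    simp only [inner_def]
    rw [mul_left_comm, ← integral_const_mul ((starRingEnd ℂ) c)]
    congr 2
    funext z
    simp only [smul_apply, map_mul]
    ring
  definite f hf := by
    rw [inner_self_eq] at hf
    have hpi : (Real.pi ^ d)⁻¹ ≠ 0 := by
      have := Real.pi_pos
      positivity
    have h0 : ∫ z, ‖f z‖ ^ 2 * Real.exp (-‖z‖ ^ 2) = 0 := by
      rcases mul_eq_zero.1 (Complex.ofReal_eq_zero.1 hf) with h | h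
      · exact absurd h hpi
      · exact h
    rw [integral_eq_zero_iff_of_nonneg (fun z => by positivity) f.integrable_sq] at h0
    have hc : Continuous (fun z => ‖f z‖ ^ 2 * Real.exp (-‖z‖ ^ 2)) := by
      have := f.continuous
      fun_prop
    have h1 := (Continuous.ae_eq_iff_eq volume hc continuous_const).1 h0
    refine coe_ext fun z => ?_
    have h2 := congrFun h1 z
    have h3 := (mul_eq_zero.1 h2).resolve_right (Real.exp_pos _).ne'
    simpa using h3

instance : NormedAddCommGroup (FockSpace d) := (innerCore d).toNormedAddCommGroup

instance : InnerProductSpace ℂ (FockSpace d) := InnerProductSpace.ofCore (innerCore d).toCore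

theorem norm_sq_eq (f : FockSpace d) :
    ‖f‖ ^ 2 = (Real.pi ^ d)⁻¹ * ∫ z, ‖f z‖ ^ 2 * Real.exp (-‖z‖ ^ 2) := by
  have h : ((‖f‖ : ℂ)) ^ 2 = inner ℂ f f := (inner_self_eq_norm_sq_to_K f).symm
  rw [inner_self_eq] at h
  exact_mod_cast h

/-- Sub-mean value property of `|f|^2` on balls. -/
theorem sub_mean_value {f : EuclideanSpace ℂ (Fin d) → ℂ} (hf : Differentiable ℂ f)
    (z : EuclideanSpace ℂ (Fin d)) :
    volume.real (Metric.closedBall (0 : EuclideanSpace ℂ (Fin d)) 1) * ‖f z‖ ^ 2 ≤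
      ∫ w in Metric.closedBall (0 : EuclideanSpace ℂ (Fin d)) 1, ‖f (z + w)‖ ^ 2 := by
  have hfc := hf.continuous
  set B := Metric.closedBall (0 : EuclideanSpace ℂ (Fin d)) 1 with hB
  have hBc : IsCompact B := isCompact_closedBall _ _
  have hcirc : Continuous (fun θ : ℝ => circleMap 0 1 θ) := continuous_circleMap 0 1
  have h2pi : (0 : ℝ) ≤ 2 * Real.pi := by positivity
  have hpt : ∀ w, ‖f z‖ ^ 2 ≤
      (2 * Real.pi)⁻¹ * ∫ θ in (0 : ℝ)..2 * Real.pi, ‖f (z + circleMap 0 1 θ • w)‖ ^ 2 := by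
    intro w
    have hd : Differentiable ℂ (fun t : ℂ => f (z + t • w) ^ 2) := by
      fun_prop
    have h := (hd.diffContOnCl (s := Metric.ball (0 : ℂ) |1|)).circleAverage
    simp only [zero_smul, add_zero, Real.circleAverage] at h
    rw [← norm_pow, ← h, norm_smul, Real.norm_of_nonneg (by positivity)]
    gcongr
    refine (intervalIntegral.norm_integral_le_integral_norm h2pi).trans_eq ?_
    simp
  have hrot : ∀ θ : ℝ, ∫ w in B, ‖f (z + circleMap 0 1 θ • w)‖ ^ 2 = ∫ w in B, ‖f (z + w)‖ ^ 2 := by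
    intro θ
    have hu : ‖circleMap 0 1 θ‖ = 1 := by simp
    let e : EuclideanSpace ℂ (Fin d) ≃ₗᵢ[ℝ] EuclideanSpace ℂ (Fin d) :=
      { toLinearEquiv := (LinearEquiv.smulOfNeZero ℂ (EuclideanSpace ℂ (Fin d)) (circleMap 0 1 θ)
          (by rw [← norm_ne_zero_iff, hu]; exact one_ne_zero)).restrictScalars ℝ
        norm_map' := fun w => by
          change ‖circleMap 0 1 θ • w‖ = ‖w‖
          rw [norm_smul, hu, one_mul] }
    have he : ∀ w, e w = circleMap 0 1 θ • w := fun _ => rfl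
    have hpre : e ⁻¹' B = B := by
      ext w
      simp [hB]
    have := e.measurePreserving.setIntegral_preimage_emb
      e.toHomeomorph.measurableEmbedding (fun w => ‖f (z + w)‖ ^ 2) B
    rw [hpre] at this
    simpa only [he] using this
  have hjc : Continuous (fun p : EuclideanSpace ℂ (Fin d) × ℝ =>
      ‖f (z + circleMap 0 1 p.2 • p.1)‖ ^ 2) := by
    have : Continuous (fun p : EuclideanSpace ℂ (Fin d) × ℝ => circleMap 0 1 p.2) :=
      hcirc.comp continuous_snd
    fun_prop
  have hint : Integrable (fun p : EuclideanSpace ℂ (Fin d) × ℝ =>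
      ‖f (z + circleMap 0 1 p.2 • p.1)‖ ^ 2)
      ((volume.restrict B).prod (volume.restrict (Set.Ioc 0 (2 * Real.pi)))) := by
    rw [Measure.prod_restrict]
    exact (hjc.continuousOn.integrableOn_compact (hBc.prod isCompact_Icc)).mono_set
      (Set.prod_mono_right Set.Ioc_subset_Icc_self)
  calc volume.real B * ‖f z‖ ^ 2 = ∫ _w in B, ‖f z‖ ^ 2 := by simp
    _ ≤ ∫ w in B, (2 * Real.pi)⁻¹ *
          ∫ θ in (0 : ℝ)..2 * Real.pi, ‖f (z + circleMap 0 1 θ • w)‖ ^ 2 := by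
        refine integral_mono (integrableOn_const hBc.measure_lt_top.ne) ?_ hpt
        simp only [intervalIntegral.integral_of_le h2pi]
        exact hint.integral_prod_left.const_mul _
    _ = (2 * Real.pi)⁻¹ *
          ∫ θ in (0 : ℝ)..2 * Real.pi, ∫ w in B, ‖f (z + circleMap 0 1 θ • w)‖ ^ 2 := by
        simp only [intervalIntegral.integral_of_le h2pi]
        rw [integral_const_mul, integral_integral_swap hint]
    _ = _ := by
        simp only [hrot, intervalIntegral.integral_const, sub_zero, smul_eq_mul]
        have := Real.pi_pos
        field_simp

/-- Point evaluations are bounded, uniformly on bounded sets. -/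
theorem exists_bound (d : ℕ) (R : ℝ) : ∃ A : ℝ, 0 ≤ A ∧
    ∀ (f : FockSpace d) (z : EuclideanSpace ℂ (Fin d)), ‖z‖ ≤ R → ‖f z‖ ≤ A * ‖f‖ := by
  set B := Metric.closedBall (0 : EuclideanSpace ℂ (Fin d)) 1 with hB
  have hV : 0 < volume.real B :=
    ENNReal.toReal_pos (Metric.measure_closedBall_pos volume _ one_pos).ne'
      (isCompact_closedBall _ _).measure_lt_top.ne
  refine ⟨Real.sqrt (Real.exp ((R + 1) ^ 2) * Real.pi ^ d / volume.real B),
    Real.sqrt_nonneg _, fun f z hz => ?_⟩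
  have hfc := f.continuous
  have hpi := Real.pi_pos
  refine le_of_sq_le_sq ?_ (by positivity)
  rw [mul_pow, Real.sq_sqrt (by positivity), norm_sq_eq]
  have hI : Integrable (fun w => ‖f (z + w)‖ ^ 2 * Real.exp (-‖z + w‖ ^ 2)) :=
    f.integrable_sq.comp_add_left z
  have h1 : ∫ w in B, ‖f (z + w)‖ ^ 2 ≤
      ∫ w in B, Real.exp ((R + 1) ^ 2) * (‖f (z + w)‖ ^ 2 * Real.exp (-‖z + w‖ ^ 2)) := by
    refine setIntegral_mono_on ?_ (hI.const_mul _).integrableOn measurableSet_closedBall ?_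
    · exact ContinuousOn.integrableOn_compact (isCompact_closedBall _ _)
        (Continuous.continuousOn (by fun_prop))
    · intro w hw
      have hw1 : ‖w‖ ≤ 1 := by simpa [hB] using hw
      have hzw : ‖z + w‖ ^ 2 ≤ (R + 1) ^ 2 := by
        have := norm_add_le z w
        gcongr
        linarith
      have h3 : 1 ≤ Real.exp ((R + 1) ^ 2) * Real.exp (-‖z + w‖ ^ 2) := by
        rw [← Real.exp_add]
        exact Real.one_le_exp (by linarith)
      calc ‖f (z + w)‖ ^ 2 = ‖f (z + w)‖ ^ 2 * 1 := (mul_one _).symm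
        _ ≤ ‖f (z + w)‖ ^ 2 * (Real.exp ((R + 1) ^ 2) * Real.exp (-‖z + w‖ ^ 2)) := by gcongr
        _ = _ := by ring
  have h2 : ∫ w in B, Real.exp ((R + 1) ^ 2) * (‖f (z + w)‖ ^ 2 * Real.exp (-‖z + w‖ ^ 2)) ≤
      Real.exp ((R + 1) ^ 2) * ∫ w, ‖f w‖ ^ 2 * Real.exp (-‖w‖ ^ 2) := by
    rw [integral_const_mul]
    gcongr
    refine (setIntegral_le_integral hI (Eventually.of_forall fun w => by positivity)).trans_eq ?_
    exact integral_add_left_eq_self (fun w => ‖f w‖ ^ 2 * Real.exp (-‖w‖ ^ 2)) z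
  have h := (sub_mean_value f.differentiable z).trans (h1.trans h2)
  rw [div_mul_eq_mul_div, le_div_iff₀ hV]
  calc _ = volume.real B * ‖f z‖ ^ 2 := mul_comm _ _
    _ ≤ _ := h
    _ = _ := by field_simp

/-- Derivative evaluations are bounded, uniformly on bounded sets. -/
theorem exists_bound_fderiv (d : ℕ) (R : ℝ) : ∃ A : ℝ, 0 ≤ A ∧
    ∀ (f : FockSpace d) (z : EuclideanSpace ℂ (Fin d)), ‖z‖ ≤ R → ‖fderiv ℂ f z‖ ≤ A * ‖f‖ := by
  obtain ⟨A, hA, h⟩ := exists_bound d (R + 1)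
  refine ⟨A, hA, fun f z hz => ?_⟩
  refine ContinuousLinearMap.opNorm_le_of_unit_norm (𝕜 := ℂ) (by positivity) fun v hv => ?_
  have hd : Differentiable ℂ (fun t : ℂ => f (z + t • v)) := by
    have := f.differentiable
    fun_prop
  have hder : HasDerivAt (fun t : ℂ => f (z + t • v)) (fderiv ℂ f z v) 0 := by
    have h1 : HasFDerivAt f (fderiv ℂ f z) (z + (0 : ℂ) • v) := by
      simpa using (f.differentiable z).hasFDerivAt
    have h2 : HasDerivAt (fun t : ℂ => z + t • v) v 0 := by
      simpa using ((hasDerivAt_id (0 : ℂ)).smul_const v).const_add z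
    exact h1.comp_hasDerivAt (0 : ℂ) h2
  have := Complex.norm_deriv_le_of_forall_mem_sphere_norm_le (C := A * ‖f‖) one_pos
    (hd.diffContOnCl (s := Metric.ball (0 : ℂ) 1)) (fun t ht => by
      refine h f _ ((norm_add_le _ _).trans ?_)
      have : ‖t‖ = 1 := by simpa using ht
      rw [norm_smul, this, hv]
      linarith)
  rwa [hder.deriv, div_one] at this

/-- The Fock space is a Hilbert space. -/
instance : CompleteSpace (FockSpace d) := by
  refine Metric.complete_of_cauchySeq_tendsto fun u hu => ?_
  have hC : ∀ ε > 0, ∃ N, ∀ m ≥ N, ∀ n ≥ N, ‖u m - u n‖ < ε := by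
    intro ε hε
    obtain ⟨N, hN⟩ := Metric.cauchySeq_iff.1 hu ε hε
    exact ⟨N, fun m hm n hn => by simpa [dist_eq_norm] using hN m hm n hn⟩
  have hptC : ∀ z, CauchySeq fun n => u n z := by
    intro z
    obtain ⟨A, hA, h⟩ := exists_bound d ‖z‖
    refine Metric.cauchySeq_iff.2 fun ε hε => ?_
    obtain ⟨N, hN⟩ := hC (ε / (A + 1)) (by positivity)
    refine ⟨N, fun m hm n hn => ?_⟩
    rw [dist_eq_norm, ← sub_apply]
    calc _ ≤ A * ‖u m - u n‖ := h _ _ le_rfl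
      _ ≤ (A + 1) * ‖u m - u n‖ := by gcongr; linarith
      _ < (A + 1) * (ε / (A + 1)) := by gcongr; exact hN m hm n hn
      _ = ε := by field_simp
  choose F hF using fun z => cauchySeq_tendsto_of_complete (hptC z)
  have hfd : ∀ m n z, fderiv ℂ (u m) z - fderiv ℂ (u n) z = fderiv ℂ (u m - u n : FockSpace d) z :=
    fun m n z => (fderiv_sub ((u m).differentiable z) ((u n).differentiable z)).symm
  have hunif : ∀ R, UniformCauchySeqOn (fun n z => fderiv ℂ (u n) z) atTop
      (Metric.ball (0 : EuclideanSpace ℂ (Fin d)) R) := by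
    intro R
    obtain ⟨A, hA, h⟩ := exists_bound_fderiv d R
    refine Metric.uniformCauchySeqOn_iff.2 fun ε hε => ?_
    obtain ⟨N, hN⟩ := hC (ε / (A + 1)) (by positivity)
    refine ⟨N, fun m hm n hn z hz => ?_⟩
    rw [dist_eq_norm, hfd]
    calc _ ≤ A * ‖u m - u n‖ := h _ _ (by simpa using (Metric.mem_ball.1 hz).le)
      _ ≤ (A + 1) * ‖u m - u n‖ := by gcongr; linarith
      _ < (A + 1) * (ε / (A + 1)) := by gcongr; exact hN m hm n hn
      _ = ε := by field_simp
  have hFd : ∀ z, ∃ L, Tendsto (fun n => fderiv ℂ (u n) z) atTop (𝓝 L) := fun z =>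
    cauchySeq_tendsto_of_complete ((hunif (‖z‖ + 1)).cauchySeq (by simp))
  choose F' hF' using hFd
  have hFdiff : Differentiable ℂ F := by
    intro z
    refine (hasFDerivAt_of_tendstoUniformlyOn (Metric.isOpen_ball (x := 0) (ε := ‖z‖ + 1))
      ((hunif (‖z‖ + 1)).tendstoUniformlyOn_of_tendsto fun w _ => hF' w)
      (fun n w _ => ((u n).differentiable w).hasFDerivAt) (fun w _ => hF w)
      (by simp)).differentiableAt
  have hpi := Real.pi_pos
  have hFc := hFdiff.continuous
  -- Fatou's lemma
  have hfat : ∀ ε > 0, ∃ N, ∀ n ≥ N,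
      ∫⁻ z, ENNReal.ofReal (‖F z - u n z‖ ^ 2 * Real.exp (-‖z‖ ^ 2)) ≤
        ENNReal.ofReal (Real.pi ^ d * ε ^ 2) := by
    intro ε hε
    obtain ⟨N, hN⟩ := hC ε hε
    refine ⟨N, fun n hn => ?_⟩
    have hun := (u n).continuous
    have hlim : ∀ z, Tendsto (fun m => ENNReal.ofReal (‖u m z - u n z‖ ^ 2 * Real.exp (-‖z‖ ^ 2)))
        atTop (𝓝 (ENNReal.ofReal (‖F z - u n z‖ ^ 2 * Real.exp (-‖z‖ ^ 2)))) := fun z =>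
      (ENNReal.continuous_ofReal.tendsto _).comp
        ((((hF z).sub_const _).norm.pow 2).mul_const _)
    calc _ = ∫⁻ z, liminf (fun m =>
          ENNReal.ofReal (‖u m z - u n z‖ ^ 2 * Real.exp (-‖z‖ ^ 2))) atTop :=
          lintegral_congr fun z => (hlim z).liminf_eq.symm
      _ ≤ liminf (fun m => ∫⁻ z,
          ENNReal.ofReal (‖u m z - u n z‖ ^ 2 * Real.exp (-‖z‖ ^ 2))) atTop := by
          refine lintegral_liminf_le fun m => ?_
          have hum := (u m).continuous
          refine (ENNReal.continuous_ofReal.comp ?_).measurable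
          fun_prop
      _ ≤ _ := by
          refine liminf_le_of_frequently_le' (Eventually.frequently ?_)
          filter_upwards [eventually_ge_atTop N] with m hm
          have h1 := norm_sq_eq (u m - u n)
          have h2 : ‖u m - u n‖ ^ 2 ≤ ε ^ 2 := by
            have := (hN m hm n hn).le
            gcongr
          have hi := (u m - u n).integrable_sq
          simp only [sub_apply] at hi h1
          rw [← ofReal_integral_eq_lintegral_ofReal hi
            (Eventually.of_forall fun z => by positivity)]
          refine ENNReal.ofReal_le_ofReal ?_
          rw [h1] at h2
          rwa [inv_mul_le_iff₀ (by positivity)] at h2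
  have hint : ∀ n, (∫⁻ z, ENNReal.ofReal (‖F z - u n z‖ ^ 2 * Real.exp (-‖z‖ ^ 2)) < ⊤) →
      GaussSqIntegrable (F - ⇑(u n)) := by
    intro n hn
    have hun := (u n).continuous
    refine ⟨?_, ?_⟩
    · apply Continuous.aestronglyMeasurable
      simp only [Pi.sub_apply]
      fun_prop
    · rw [hasFiniteIntegral_iff_ofReal (Eventually.of_forall fun z => by positivity)]
      exact hn
  obtain ⟨N₁, hN₁⟩ := hfat 1 one_pos
  have hFmem : F ∈ fockSubmodule d := by
    have h1 : F - ⇑(u N₁) ∈ fockSubmodule d := ⟨hFdiff.sub (u N₁).differentiable,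
      hint N₁ ((hN₁ N₁ le_rfl).trans_lt ENNReal.ofReal_lt_top)⟩
    have h2 := (fockSubmodule d).add_mem h1 (u N₁).coe_mem
    rwa [sub_add_cancel] at h2
  let G : FockSpace d := mk F hFmem
  refine ⟨G, Metric.tendsto_atTop.2 fun ε hε => ?_⟩
  obtain ⟨N, hN⟩ := hfat (ε / 2) (by positivity)
  refine ⟨N, fun n hn => ?_⟩
  rw [dist_comm, dist_eq_norm]
  have h1 := norm_sq_eq (G - u n)
  have h2 := hN n hn
  have hi := (G - u n).integrable_sq
  have h3 : ∫ z, ‖(G - u n) z‖ ^ 2 * Real.exp (-‖z‖ ^ 2) ≤ Real.pi ^ d * (ε / 2) ^ 2 := by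
    rw [← ENNReal.ofReal_le_ofReal_iff (by positivity),
      ofReal_integral_eq_lintegral_ofReal hi (Eventually.of_forall fun z => by positivity)]
    exact h2
  have h4 : ‖G - u n‖ ^ 2 ≤ (ε / 2) ^ 2 := by
    rw [h1, inv_mul_le_iff₀ (by positivity)]
    exact h3
  have h5 : ‖G - u n‖ ≤ ε / 2 := le_of_sq_le_sq h4 (by positivity)
  linarith

end FockSpace

/-- The weighted composition expression `f ↦ ψ · (f ∘ φ)`. -/
def weightedComp {d : ℕ} (ψ : EuclideanSpace ℂ (Fin d) → ℂ)
    (φ : EuclideanSpace ℂ (Fin d) → EuclideanSpace ℂ (Fin d))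
    (f : EuclideanSpace ℂ (Fin d) → ℂ) : EuclideanSpace ℂ (Fin d) → ℂ :=
  fun z => ψ z * f (φ z)

/-- The maximal weighted composition operator on the Fock space: its domain consists of all `f` in
the Fock space for which `ψ · (f ∘ φ)` is in the Fock space. -/
def maxWeightedComp {d : ℕ} (ψ : EuclideanSpace ℂ (Fin d) → ℂ)
    (φ : EuclideanSpace ℂ (Fin d) → EuclideanSpace ℂ (Fin d)) :
    FockSpace d →ₗ.[ℂ] FockSpace d where
  domain :=
    { carrier := {f | weightedComp ψ φ f ∈ fockSubmodule d}
      zero_mem' := by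
        change weightedComp ψ φ _ ∈ fockSubmodule d
        convert (fockSubmodule d).zero_mem using 1
        funext z
        simp [weightedComp]
      add_mem' := fun {f g} hf hg => by
        change weightedComp ψ φ _ ∈ fockSubmodule d
        convert (fockSubmodule d).add_mem hf hg using 1
        funext z
        simp [weightedComp, mul_add]
      smul_mem' := fun c f hf => by
        change weightedComp ψ φ _ ∈ fockSubmodule d
        convert (fockSubmodule d).smul_mem c hf using 1
        funext z
        simp [weightedComp, mul_left_comm] }
  toFun :=
    { toFun := fun f => FockSpace.mk (weightedComp ψ φ (f : FockSpace d)) f.2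
      map_add' := fun f g => FockSpace.coe_ext fun z => mul_add _ _ _
      map_smul' := fun c f => FockSpace.coe_ext fun z => mul_left_comm _ _ _ }

/-- `T` is a weighted composition operator with symbols `ψ`, `φ`: a restriction of the maximal one
to some linear subspace. -/
def IsWeightedComp {d : ℕ} (ψ : EuclideanSpace ℂ (Fin d) → ℂ)
    (φ : EuclideanSpace ℂ (Fin d) → EuclideanSpace ℂ (Fin d))
    (T : FockSpace d →ₗ.[ℂ] FockSpace d) : Prop :=
  T ≤ maxWeightedComp ψ φ

/-- `T = T*` as unbounded operators; the adjoint is that of a densely defined operator. -/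
def IsRealSymmetric {d : ℕ} (T : FockSpace d →ₗ.[ℂ] FockSpace d) : Prop :=
  Dense (T.domain : Set (FockSpace d)) ∧ T = T†

/-- `T = -T*` as unbounded operators; the adjoint is that of a densely defined operator. -/
def IsSkewRealSymmetric {d : ℕ} (T : FockSpace d →ₗ.[ℂ] FockSpace d) : Prop :=
  Dense (T.domain : Set (FockSpace d)) ∧ T = -T†

/-- `ψ(z) = θ exp ⟨z, q⟩` and `φ(z) = Q z + q` with `Q = Q*` and `θ ∈ Θ`. Here
`⟨z, q⟩ = ∑ i, z i * conj (q i)`, which is `inner ℂ q z` in Mathlib. -/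
def HasHermitianForm {d : ℕ} (Θ : Set ℂ) (ψ : EuclideanSpace ℂ (Fin d) → ℂ)
    (φ : EuclideanSpace ℂ (Fin d) → EuclideanSpace ℂ (Fin d)) : Prop :=
  ∃ (Q : Matrix (Fin d) (Fin d) ℂ) (q : EuclideanSpace ℂ (Fin d)) (θ : ℂ),
    Q.IsHermitian ∧ θ ∈ Θ ∧
    (∀ z, ψ z = θ * Complex.exp (inner ℂ q z)) ∧
    ∀ z, φ z = Matrix.toEuclideanLin Q z + q

end

/-! Both cases read `T = ε T*` with `ε = ±1`, and the reproducing kernels `K_w(z) = exp ⟨z, w⟩`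
decide almost everything. If `T = ε T*`, every `K_w` lies in the domain and `T K_w = ε conj(ψ w)
K_{φ w}`. Evaluated at `z` this is a functional equation in `(z, w)`: `w = 0` determines `ψ`, and
comparing exponents makes `φ - φ 0` its own formal adjoint, hence linear and Hermitian
(`hasHermitianForm_of_isTwistedSelfAdjoint`).

Conversely, let `S` be the maximal operator of symbols of Hermitian form. Its explicit action on
kernels gives `ε S* ⊆ S`. For `S ⊆ ε S*`, project a point of the graph of `S` onto the closed graph
of `ε S*`: the remainder `(h, k)` satisfies `k = S h` and `S k = -ε h`. With `S = θ W` and `m = |θ|`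
this is `(W - i/m)(W + i/m) h = 0`, so it suffices that `W` has no eigenvalue `iκ` with `κ ≠ 0`
real. Symmetry of `W` on the maximal domain is what is being proved, so function theory must exclude
such eigenvalues (`eq_zero_of_imaginary_eigenvalue`).

In `exp ⟨z, q⟩ f(A z + q) = iκ f(z)` a Weyl shift makes `q` a fixed vector of `A`. On the fixed
space the equation is a translation along complex lines; a Gaussian factor turns `f` into a bounded
quasiperiodic entire function, and Liouville applies. Derivatives along the other eigenvectors of
`A` solve the same equation with `κ` divided by a real eigenvalue, so Taylor expansion carries the
vanishing to the whole space. -/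

/-! ### Imaginary eigenvalues: one complex variable. -/

section Uniqueness

/-- An entire function that is multiplied by a unimodular constant `c ≠ 1` under the translation by
`1` and is bounded on a strip vanishes. -/
theorem eq_zero_of_quasiperiodic {K : ℂ → ℂ} (hK : Differentiable ℂ K) {c : ℂ} (hc : ‖c‖ = 1)
    (hc1 : c ≠ 1) (hper : ∀ t, K (t + 1) = c * K t) {C : ℝ}
    (hC : ∀ t : ℂ, 0 ≤ t.re → t.re ≤ 1 → ‖K t‖ ≤ C) (t : ℂ) : K t = 0 := by
  have hp : Function.Periodic (fun t => ‖K t‖) 1 := fun t => by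
    simp only [hper, norm_mul, hc, one_mul]
  have hb : ∀ t, ‖K t‖ ≤ C := by
    intro t
    have h1 := hp.sub_zsmul_eq (x := t) ⌊t.re⌋
    simp only [zsmul_eq_mul, mul_one] at h1
    rw [← h1]
    refine hC _ ?_ ?_
    · simp
    · simpa using (Int.fract_lt_one t.re).le
  have hbd : Bornology.IsBounded (Set.range K) := by
    rw [isBounded_iff_forall_norm_le]
    exact ⟨C, by rintro _ ⟨t, rfl⟩; exact hb t⟩
  -- By Liouville `K` is constant, and a constant with `K = c K`, `c ≠ 1`, is zero.
  have h1 := hper t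
  rw [hK.apply_eq_apply_of_bounded hbd (t + 1) t] at h1
  have h2 : (1 - c) * K t = 0 := by linear_combination h1
  exact (mul_eq_zero.1 h2).resolve_left (sub_ne_zero.2 hc1.symm)

/-- An entire function `g` of Gaussian growth with `exp (a t) g (t + 1) = i κ g t` vanishes. -/
theorem eq_zero_of_exp_mul_translate {g : ℂ → ℂ} (hg : Differentiable ℂ g) {a κ C : ℝ} (ha : 0 ≤ a)
    (hκ : κ ≠ 0) (heq : ∀ t, Complex.exp (a * t) * g (t + 1) = Complex.I * κ * g t)
    (hC : ∀ t, ‖g t‖ ≤ C * Real.exp (‖t‖ ^ 2 * a / 2)) (t : ℂ) : g t = 0 := by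
  -- Completing the square: under `t ↦ t + 1` the factor `exp (a t² / 2 - b t)` gains `exp (a t) exp
  -- (a / 2 - b)`, and this `b` makes the last exponential `1 / |κ|`. The multiplier left over is
  -- `iκ / |κ| = ±i`, unimodular and not `1`.
  set b : ℝ := Real.log |κ| + a / 2 with hb
  have hκ' : (|κ| : ℝ) ≠ 0 := abs_ne_zero.2 hκ
  have hκc : ((|κ| : ℝ) : ℂ) ≠ 0 := by exact_mod_cast hκ'
  have hC0 : 0 ≤ C := by
    have := (norm_nonneg _).trans (hC 0)
    simpa using this
  have key := eq_zero_of_quasiperiodic (K := fun t => Complex.exp (a * t ^ 2 / 2 - b * t) * g t)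
    (by fun_prop) (c := Complex.I * κ / (|κ| : ℝ)) ?_ ?_ ?_
    (C := C * Real.exp (a + |b|)) ?_ t
  · exact (mul_eq_zero.1 key).resolve_left (Complex.exp_ne_zero _)
  · simp [hκ]
  · intro h
    have := congrArg Complex.re h
    rw [mul_div_assoc, ← Complex.ofReal_div] at this
    simp at this
  · intro t
    have he : Complex.exp (a * (t + 1) ^ 2 / 2 - b * (t + 1)) =
        Complex.exp (a * t ^ 2 / 2 - b * t) * Complex.exp (a * t) * (((|κ| : ℝ) : ℂ))⁻¹ := by
      have : (((|κ| : ℝ) : ℂ))⁻¹ = Complex.exp (-(Real.log |κ| : ℝ)) := by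
        rw [Complex.exp_neg, ← Complex.ofReal_exp, Real.exp_log (abs_pos.2 hκ)]
      rw [this, ← Complex.exp_add, ← Complex.exp_add]
      congr 1
      rw [hb]
      push_cast
      ring
    rw [he]
    calc _ = Complex.exp (a * t ^ 2 / 2 - b * t) * (((|κ| : ℝ) : ℂ))⁻¹ *
          (Complex.exp (a * t) * g (t + 1)) := by ring
      _ = _ := by rw [heq]; ring
  · intro t h0 h1
    rw [norm_mul, Complex.norm_exp]
    have hre : (a * t ^ 2 / 2 - b * t : ℂ).re = a * (t.re ^ 2 - t.im ^ 2) / 2 - b * t.re := by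
      have : (a * t ^ 2 / 2 - b * t : ℂ) = ((a / 2 : ℝ) : ℂ) * t ^ 2 - b * t := by
        push_cast; ring
      rw [this, Complex.sub_re, Complex.re_ofReal_mul, Complex.re_ofReal_mul, pow_two,
        Complex.mul_re]
      ring
    calc _ ≤ Real.exp (a * (t.re ^ 2 - t.im ^ 2) / 2 - b * t.re) *
          (C * Real.exp (‖t‖ ^ 2 * a / 2)) := by
          rw [hre]
          gcongr
          exact hC t
      -- The `t.im` terms cancel because the growth rate `a / 2` is exactly that of the Gaussian
      -- factor.
      _ = C * Real.exp (a * t.re ^ 2 - b * t.re) := by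
          rw [mul_left_comm, ← Real.exp_add, Complex.sq_norm, Complex.normSq_apply]
          ring_nf
      _ ≤ _ := by
          gcongr
          have h2 : a * t.re ^ 2 ≤ a * 1 := by
            gcongr
            nlinarith
          have h3 : -(b * t.re) ≤ |b| := by
            calc -(b * t.re) ≤ |b * t.re| := neg_le_abs _
              _ = |b| * t.re := by rw [abs_mul, abs_of_nonneg h0]
              _ ≤ |b| * 1 := by gcongr
              _ = |b| := mul_one _
          linarith

/-! ### Transverse growth and directional derivatives. -/

variable {E : Type*} [NormedAddCommGroup E] [InnerProductSpace ℂ E]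

/-- `f` grows at most like `exp (‖t • q‖ ^ 2 / 2)` along the complex lines in direction `q`, locally
uniformly in the directions orthogonal to `q`. -/
def TransverseGaussGrowth (q : E) (f : E → ℂ) : Prop :=
  ∀ R : ℝ, ∃ C : ℝ, ∀ (z : E) (t : ℂ), ‖z‖ ≤ R → inner ℂ q z = 0 →
    ‖f (z + t • q)‖ ≤ C * Real.exp (‖t‖ ^ 2 * ‖q‖ ^ 2 / 2)

theorem hasDerivAt_line {f : E → ℂ} (hf : Differentiable ℂ f) (z v : E) (t : ℂ) :
    HasDerivAt (fun t : ℂ => f (z + t • v)) (fderiv ℂ f (z + t • v) v) t := by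
  have h2 : HasDerivAt (fun t : ℂ => z + t • v) v t := by
    simpa using ((hasDerivAt_id t).smul_const v).const_add z
  exact (hf _).hasFDerivAt.comp_hasDerivAt t h2

/-- Cauchy's estimate on a unit circle in direction `v`: since `v ⊥ q`, the circle changes only the
transverse part, so the Gaussian in `t` is kept and `R` grows by `1`. The estimate from a full bound
`exp (‖z‖ ^ 2 / 2)` would not return the same bound, whence this growth condition. -/
theorem TransverseGaussGrowth.fderiv_apply {q : E} {f : E → ℂ} (hf : Differentiable ℂ f)
    (h : TransverseGaussGrowth q f) {v : E} (hv : ‖v‖ = 1) (hqv : inner ℂ q v = 0) :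
    TransverseGaussGrowth q (fun z => fderiv ℂ f z v) := by
  intro R
  obtain ⟨C, hC⟩ := h (R + 1)
  refine ⟨C, fun z t hz hqz => ?_⟩
  have hder := hasDerivAt_line hf (z + t • q) v 0
  have hd : Differentiable ℂ (fun s : ℂ => f (z + t • q + s • v)) := fun s =>
    (hasDerivAt_line hf (z + t • q) v s).differentiableAt
  have := Complex.norm_deriv_le_of_forall_mem_sphere_norm_le
    (C := C * Real.exp (‖t‖ ^ 2 * ‖q‖ ^ 2 / 2)) one_pos
    (hd.diffContOnCl (s := Metric.ball (0 : ℂ) 1)) (fun s hs => by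
      have hs1 : ‖s‖ = 1 := by simpa using hs
      rw [add_right_comm]
      refine hC _ _ ((norm_add_le _ _).trans ?_) ?_
      · rw [norm_smul, hs1, hv]
        linarith
      · rw [inner_add_right, inner_smul_right, hqz, hqv]
        simp)
  rwa [hder.deriv, zero_smul, add_zero, div_one] at this

/-- Cauchy's formula writes the directional derivative as a circle integral of `f`, which may be
differentiated under the integral sign. -/
theorem differentiable_fderiv_apply [FiniteDimensional ℂ E] {f : E → ℂ} (hf : Differentiable ℂ f) (v : E) :
    Differentiable ℂ (fun z => fderiv ℂ f z v) := by
  have : ProperSpace E := FiniteDimensional.proper ℂ E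
  borelize E
  intro z₀
  have hc := hf.continuous
  -- The radius leaves room for `z` within `1` of `z₀`, for the circle of radius `‖v‖`, and for the
  -- unit circle in the Cauchy estimate of `fderiv`.
  obtain ⟨M, hM⟩ := (isCompact_closedBall (0 : E) (‖z₀‖ + 1 + ‖v‖ + 1)).exists_bound_of_continuousOn
    hc.continuousOn
  have hbound : ∀ z : E, ‖z‖ ≤ ‖z₀‖ + 1 + ‖v‖ → ‖fderiv ℂ f z‖ ≤ M := by
    intro z hz
    refine ContinuousLinearMap.opNorm_le_of_unit_norm (𝕜 := ℂ)
      ((norm_nonneg _).trans (hM 0 (by simp; positivity))) fun u hu => ?_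
    have hd : Differentiable ℂ (fun t : ℂ => f (z + t • u)) := fun t =>
      (hasDerivAt_line hf z u t).differentiableAt
    have := Complex.norm_deriv_le_of_forall_mem_sphere_norm_le (C := M) one_pos
      (hd.diffContOnCl (s := Metric.ball (0 : ℂ) 1)) (fun t ht => by
        have ht1 : ‖t‖ = 1 := by simpa using ht
        refine hM _ (mem_closedBall_zero_iff.2 ((norm_add_le _ _).trans ?_))
        rw [norm_smul, ht1, hu]
        linarith)
    rwa [(hasDerivAt_line hf z u 0).deriv, zero_smul, add_zero, div_one] at this
  set k : ℝ → ℂ := fun θ => (2 * Real.pi * Complex.I : ℂ)⁻¹ *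
    (deriv (circleMap 0 1) θ * ((circleMap 0 1 θ) ^ 2)⁻¹) with hk
  have hcirc : Continuous (circleMap 0 1) := continuous_circleMap 0 1
  have hkc : Continuous k := by
    have : ∀ θ, circleMap 0 1 θ ^ 2 ≠ 0 := fun θ => pow_ne_zero 2 (circleMap_ne_center one_ne_zero)
    simp only [hk, deriv_circleMap]
    fun_prop (disch := exact this)
  have hrep : ∀ z, fderiv ℂ f z v =
      ∫ θ in (0 : ℝ)..2 * Real.pi, k θ * f (z + circleMap 0 1 θ • v) := by
    intro z
    have hd : Differentiable ℂ (fun t : ℂ => f (z + t • v)) := fun t =>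
      (hasDerivAt_line hf z v t).differentiableAt
    have h := (hd.diffContOnCl (s := Metric.ball (0 : ℂ) 1)).deriv_eq_smul_circleIntegral one_pos
    rw [(hasDerivAt_line hf z v 0).deriv, zero_smul, add_zero] at h
    have h2 : (2 * Real.pi * Complex.I : ℂ) ≠ 0 := Complex.two_pi_I_ne_zero
    rw [eq_inv_smul_iff₀ h2 |>.2 h.symm, circleIntegral, ← intervalIntegral.integral_smul]
    refine intervalIntegral.integral_congr fun θ _ => ?_
    simp only [hk, smul_eq_mul, sub_zero]
    ring
  obtain ⟨B, hB⟩ := (isCompact_Icc (a := (0 : ℝ)) (b := 2 * Real.pi)).exists_bound_of_continuousOn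
    hkc.continuousOn
  have hder := intervalIntegral.hasFDerivAt_integral_of_dominated_of_fderiv_le (𝕜 := ℂ)
    (μ := volume) (a := 0) (b := 2 * Real.pi) (s := Metric.ball z₀ 1)
    (F := fun z θ => k θ * f (z + circleMap 0 1 θ • v))
    (F' := fun z θ => k θ • fderiv ℂ f (z + circleMap 0 1 θ • v)) (x₀ := z₀)
    (bound := fun _ => B * M) (Metric.ball_mem_nhds z₀ one_pos)
    (Eventually.of_forall fun z => Continuous.aestronglyMeasurable (by fun_prop))
    (Continuous.intervalIntegrable (by fun_prop) _ _)
    ?_ ?_ (by simp) ?_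
  · have he : (fun z => fderiv ℂ f z v) = fun z =>
        ∫ θ in (0 : ℝ)..2 * Real.pi, k θ * f (z + circleMap 0 1 θ • v) := funext hrep
    rw [he]
    exact hder.differentiableAt
  · have h1 : Measurable fun θ : ℝ => fderiv ℂ f (z₀ + circleMap 0 1 θ • v) :=
      (measurable_fderiv ℂ f).comp (Continuous.measurable (by fun_prop))
    exact (hkc.measurable.smul h1).aestronglyMeasurable
  · refine Eventually.of_forall fun θ hθ z hz => ?_
    rw [Set.uIoc_of_le (by positivity)] at hθ
    rw [norm_smul]
    have h1 : ‖z‖ ≤ ‖z₀‖ + 1 := by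
      have := norm_sub_norm_le z z₀
      have := mem_ball_iff_norm.1 hz
      linarith
    have h2 : ‖z + circleMap 0 1 θ • v‖ ≤ ‖z₀‖ + 1 + ‖v‖ := by
      refine (norm_add_le _ _).trans ?_
      rw [norm_smul]
      simpa using h1
    have := hB θ ⟨hθ.1.le, hθ.2⟩
    gcongr
    exacts [(norm_nonneg _).trans this, hbound _ h2]
  · refine Eventually.of_forall fun θ _ z _ => ?_
    have h1 := (hf (z + circleMap 0 1 θ • v)).hasFDerivAt.comp z
      ((hasFDerivAt_id z).add_const (circleMap 0 1 θ • v))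
    rw [ContinuousLinearMap.comp_id] at h1
    exact h1.const_mul (k θ)

/-! ### The eigenvalue equation in several variables. -/

variable {A : E →ₗ[ℂ] E}

/-- Derivatives in the direction of an eigenvector orthogonal to `q`. -/
theorem exists_fderiv_equation {f : E → ℂ} (hf : Differentiable ℂ f) {q v : E} {κ l : ℝ}
    (hκ : κ ≠ 0) (hqv : inner ℂ q v = 0) (hv : A v = (l : ℂ) • v)
    (heq : ∀ z, Complex.exp (inner ℂ q z) * f (A z + q) = Complex.I * κ * f z) :
    ∃ κ' : ℝ, κ' ≠ 0 ∧ ∀ z, Complex.exp (inner ℂ q z) * fderiv ℂ f (A z + q) v =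
      Complex.I * κ' * fderiv ℂ f z v := by
  have h1 : ∀ z, (l : ℂ) * (Complex.exp (inner ℂ q z) * fderiv ℂ f (A z + q) v) =
      Complex.I * κ * fderiv ℂ f z v := by
    intro z
    have hL := (hasDerivAt_line hf (A z + q) ((l : ℂ) • v) 0).const_mul
      (Complex.exp (inner ℂ q z))
    have hR := (hasDerivAt_line hf z v 0).const_mul (Complex.I * κ)
    have he : (fun t : ℂ => Complex.exp (inner ℂ q z) * f (A z + q + t • ((l : ℂ) • v))) =
        fun t : ℂ => Complex.I * κ * f (z + t • v) := by
      funext t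
      rw [← heq, map_add, map_smul, hv, inner_add_right, inner_smul_right, hqv, mul_zero, add_zero,
        add_right_comm]
    rw [he] at hL
    have := hL.unique hR
    simp only [zero_smul, add_zero, map_smul, smul_eq_mul] at this
    rw [← this]
    ring
  have hκc : (κ : ℂ) ≠ 0 := by exact_mod_cast hκ
  -- For `l = 0` the derivative vanishes identically, so any nonzero `κ'` serves.
  by_cases hl : l = 0
  · have h2 : ∀ z, fderiv ℂ f z v = 0 := by
      intro z
      have := h1 z
      rw [hl] at this
      simpa [hκc] using this
    exact ⟨1, one_ne_zero, fun z => by simp [h2]⟩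
  · have hlc : (l : ℂ) ≠ 0 := by exact_mod_cast hl
    refine ⟨κ / l, div_ne_zero hκ hl, fun z => ?_⟩
    refine mul_left_cancel₀ hlc ?_
    rw [h1]
    push_cast
    field_simp

/-- The vanishing on the fixed space of `A`. -/
theorem eq_zero_of_fixed {f : E → ℂ} (hf : Differentiable ℂ f) {q : E} {κ : ℝ}
    (hκ : κ ≠ 0) (hAq : A q = q) (hgrow : TransverseGaussGrowth q f)
    (heq : ∀ z, Complex.exp (inner ℂ q z) * f (A z + q) = Complex.I * κ * f z)
    {z : E} (hz : A z = z) : f z = 0 := by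
  -- Coordinate of `z` along `q`. If `q = 0` the quotient is `0` and `v = z`, which still satisfies
  -- everything below.
  set t : ℂ := inner ℂ q z / (‖q‖ ^ 2 : ℝ) with ht
  set v := z - t • q with hv
  have hqq : inner ℂ q q = ((‖q‖ ^ 2 : ℝ) : ℂ) := by
    rw [inner_self_eq_norm_sq_to_K]
    norm_cast
  have hqv : inner ℂ q v = 0 := by
    rw [hv, inner_sub_right, inner_smul_right, hqq, ht]
    by_cases hq : q = 0
    · simp [hq]
    · have : ((‖q‖ ^ 2 : ℝ) : ℂ) ≠ 0 := by
        have := norm_ne_zero_iff.2 hq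
        exact_mod_cast pow_ne_zero 2 this
      field_simp
      simp
  have hAv : A v = v := by rw [hv, map_sub, map_smul, hz, hAq]
  obtain ⟨C, hC⟩ := hgrow ‖v‖
  have key := eq_zero_of_exp_mul_translate (g := fun t => f (v + t • q))
    (fun t => (hasDerivAt_line hf v q t).differentiableAt) (a := ‖q‖ ^ 2) (by positivity) hκ
    (fun s => ?_) (fun s => hC v s le_rfl hqv) t
  · simpa [hv] using key
  · rw [← heq, map_add, map_smul, hAv, hAq, inner_add_right, inner_smul_right, hqv, hqq, add_smul,
      one_smul, zero_add, mul_comm s, add_assoc]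

/-- Induction over an eigenbasis of `A`: from the fixed space, the vanishing spreads one eigenvector
at a time through the Taylor series in its direction. -/
theorem eq_zero_of_fixed_translation [FiniteDimensional ℂ E] (hA : A.IsSymmetric) {f : E → ℂ} (hf : Differentiable ℂ f)
    {q : E} {κ : ℝ} (hκ : κ ≠ 0) (hAq : A q = q) (hgrow : TransverseGaussGrowth q f)
    (heq : ∀ z, Complex.exp (inner ℂ q z) * f (A z + q) = Complex.I * κ * f z) (z : E) :
    f z = 0 := by
  classical
  set e := hA.eigenvectorBasis rfl with he
  set l := hA.eigenvalues rfl with hl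
  have hAe : ∀ j, A (e j) = (l j : ℂ) • e j := fun j => hA.apply_eigenvectorBasis rfl j
  have horth : ∀ x, A x = x → ∀ j, l j ≠ 1 → inner ℂ (e j) x = 0 := by
    intro x hx j hj
    have h1 := hA (e j) x
    rw [hx, hAe, inner_smul_left, Complex.conj_ofReal] at h1
    have h2 : ((l j : ℂ) - 1) * inner ℂ (e j) x = 0 := by linear_combination h1
    refine (mul_eq_zero.1 h2).resolve_left (sub_ne_zero.2 ?_)
    exact_mod_cast hj
  have hfix : ∀ x, (∀ j, l j ≠ 1 → inner ℂ (e j) x = 0) → A x = x := by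
    intro x hx
    conv_lhs => rw [← e.sum_repr' x]
    conv_rhs => rw [← e.sum_repr' x]
    rw [map_sum]
    refine Finset.sum_congr rfl fun j _ => ?_
    rw [map_smul, hAe]
    by_cases hj : l j = 1
    · simp [hj]
    · simp [hx j hj]
  -- `s` collects the directions in which `z` is unrestricted. Both `f` and `κ` are quantified
  -- inside because differentiation changes them.
  have main : ∀ s : Finset (Fin (Module.finrank ℂ E)), ∀ f : E → ℂ, Differentiable ℂ f →
      TransverseGaussGrowth q f → (∃ κ : ℝ, κ ≠ 0 ∧
        ∀ z, Complex.exp (inner ℂ q z) * f (A z + q) = Complex.I * κ * f z) →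
      ∀ z, (∀ j ∉ s, l j ≠ 1 → inner ℂ (e j) z = 0) → f z = 0 := by
    intro s
    induction s using Finset.induction_on with
    | empty =>
      rintro f hf hgrow ⟨κ, hκ, heq⟩ z hz
      exact eq_zero_of_fixed hf hκ hAq hgrow heq (hfix z fun j => hz j (Finset.notMem_empty j))
    | insert j s hjs ih =>
      intro f hf hgrow hκ z hz
      by_cases hj : l j = 1
      · refine ih f hf hgrow hκ z fun i hi hi1 => hz i ?_ hi1
        rw [Finset.mem_insert, not_or]
        exact ⟨fun h => hi1 (h ▸ hj), hi⟩
      have hqe : inner ℂ q (e j) = 0 := by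
        rw [← inner_conj_symm, horth q hAq j hj, map_zero]
      set x := z - (inner ℂ (e j) z : ℂ) • e j with hx
      have hxs : ∀ i ∉ s, l i ≠ 1 → inner ℂ (e i) x = 0 := by
        intro i hi hi1
        rw [hx, inner_sub_right, inner_smul_right]
        by_cases hij : i = j
        · subst hij
          simp
        · rw [e.inner_eq_zero hij, mul_zero, sub_zero]
          exact hz i (by simp [hij, hi]) hi1
      -- Each derivative along `e j` is again an admissible `f`, so `ih` kills it at `x`.
      have hiter : ∀ n : ℕ, ∀ f : E → ℂ, Differentiable ℂ f → TransverseGaussGrowth q f →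
          (∃ κ : ℝ, κ ≠ 0 ∧
            ∀ z, Complex.exp (inner ℂ q z) * f (A z + q) = Complex.I * κ * f z) →
          iteratedDeriv n (fun t : ℂ => f (x + t • e j)) 0 = 0 := by
        intro n
        induction n with
        | zero =>
          intro f hf hgrow hκ
          simpa using ih f hf hgrow hκ x hxs
        | succ n ihn =>
          rintro f hf hgrow ⟨κ, hκ, heq⟩
          rw [iteratedDeriv_succ']
          have : deriv (fun t : ℂ => f (x + t • e j)) =
              fun t : ℂ => (fun z => fderiv ℂ f z (e j)) (x + t • e j) :=
            funext fun t => (hasDerivAt_line hf x (e j) t).deriv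
          rw [this]
          exact ihn _ (differentiable_fderiv_apply hf _)
            (hgrow.fderiv_apply hf (e.norm_eq_one j) hqe)
            (exists_fderiv_equation hf hκ hqe (hAe j) heq)
      have hd : Differentiable ℂ (fun t : ℂ => f (x + t • e j)) := fun t =>
        (hasDerivAt_line hf x (e j) t).differentiableAt
      have ht := Complex.taylorSeries_eq_of_entire' 0 (inner ℂ (e j) z : ℂ) hd
      simp only [hiter _ f hf hgrow hκ, mul_zero, zero_mul, tsum_zero] at ht
      rw [hx, sub_add_cancel] at ht
      exact ht.symm
  exact main Finset.univ f hf hgrow ⟨κ, hκ, heq⟩ z (by simp)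

/-- The eigenvalue equation of a Hermitian weighted composition has no nonzero solution of Gaussian
growth for imaginary eigenvalues. -/
theorem eq_zero_of_imaginary_eigenvalue [FiniteDimensional ℂ E] (hA : A.IsSymmetric) {f : E → ℂ} (hf : Differentiable ℂ f)
    {q : E} {κ C : ℝ} (hκ : κ ≠ 0) (hC : ∀ z, ‖f z‖ ≤ C * Real.exp (‖z‖ ^ 2 / 2))
    (heq : ∀ z, Complex.exp (inner ℂ q z) * f (A z + q) = Complex.I * κ * f z) (z : E) :
    f z = 0 := by
  set B : E →ₗ[ℂ] E := LinearMap.id - A with hB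
  have hBs : B.IsSymmetric := LinearMap.IsSymmetric.id.sub hA
  -- As `1 - A` is symmetric, `q = (1 - A) p + q₀` with `q₀` in its kernel; translation by `p`
  -- removes the first summand.
  obtain ⟨y, hy, q₀, hq₀, hq⟩ := B.range.exists_add_mem_mem_orthogonal q
  obtain ⟨p, rfl⟩ := hy
  have hAq₀ : A q₀ = q₀ := by
    rw [hBs.orthogonal_range, LinearMap.mem_ker, hB] at hq₀
    simp only [LinearMap.sub_apply, LinearMap.id_apply] at hq₀
    exact (sub_eq_zero.1 hq₀).symm
  have hq' : q = p - A p + q₀ := hq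
  have hC0 : 0 ≤ C := by
    have := (norm_nonneg _).trans (hC 0)
    simpa using this
  -- the function in Weyl-shifted coordinates
  set g : E → ℂ := fun z => Complex.exp (-inner ℂ p z) * f (z + p) with hg
  have hgd : Differentiable ℂ g := by
    have : Differentiable ℂ (fun z : E => inner ℂ p z) := (innerSL ℂ p).differentiable
    fun_prop
  -- Reality of this number means that the shift rescales `κ` by the real factor `exp (-r)`, so the
  -- eigenvalue stays imaginary.
  have hpq : (starRingEnd ℂ) (inner ℂ q p + inner ℂ p q₀) = inner ℂ q p + inner ℂ p q₀ := by
    have h1 := hA p p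
    rw [map_add, inner_conj_symm, inner_conj_symm, hq']
    simp only [inner_add_left, inner_add_right, inner_sub_left, inner_sub_right]
    rw [h1]
    ring
  obtain ⟨r, hr⟩ := Complex.conj_eq_iff_real.1 hpq
  have hgeq : ∀ z, Complex.exp (inner ℂ q₀ z) * g (A z + q₀) =
      Complex.I * (κ * Real.exp (-r) : ℝ) * g z := by
    intro z
    have h1 := heq (z + p)
    have h2 : A (z + p) + q = A z + q₀ + p := by rw [map_add, hq']; abel
    rw [h2] at h1
    have h3 : inner ℂ q₀ z - inner ℂ p (A z + q₀) = inner ℂ q (z + p) - inner ℂ p z - r := by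
      rw [← hr, hq']
      simp only [inner_add_left, inner_add_right, inner_sub_left]
      rw [hA p z]
      ring
    simp only [hg]
    calc _ = Complex.exp (inner ℂ q₀ z - inner ℂ p (A z + q₀)) * f (A z + q₀ + p) := by
          rw [sub_eq_add_neg, Complex.exp_add]; ring
      _ = Complex.exp (-inner ℂ p z) * Complex.exp (-r) *
          (Complex.exp (inner ℂ q (z + p)) * f (A z + q₀ + p)) := by
          rw [h3, ← mul_assoc, ← Complex.exp_add, ← Complex.exp_add]
          congr 2
          ring
      _ = _ := by
          rw [h1]
          push_cast
          ring
  have hggrow : TransverseGaussGrowth q₀ g := by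
    intro R
    refine ⟨C * Real.exp (‖p‖ ^ 2 / 2) * Real.exp (R ^ 2 / 2), fun z t hz hqz => ?_⟩
    -- Pythagoras separates the two directions; the terms linear in `w` cancel against the Weyl
    -- factor.
    have h1 : ‖z + t • q₀‖ ^ 2 = ‖z‖ ^ 2 + ‖t‖ ^ 2 * ‖q₀‖ ^ 2 := by
      have : inner ℂ z (t • q₀) = 0 := by
        rw [inner_smul_right, ← inner_conj_symm, hqz, map_zero, mul_zero]
      have h := norm_add_sq_eq_norm_sq_add_norm_sq_of_inner_eq_zero _ _ this
      rw [norm_smul] at h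
      nlinarith [h]
    set w := z + t • q₀ with hw
    have h2 : ‖w + p‖ ^ 2 = ‖w‖ ^ 2 + 2 * (inner ℂ p w : ℂ).re + ‖p‖ ^ 2 := by
      rw [norm_add_sq (𝕜 := ℂ), ← inner_re_symm]
      rfl
    have hz2 : ‖z‖ ^ 2 ≤ R ^ 2 := by gcongr
    calc ‖g w‖ ≤ Real.exp (-(inner ℂ p w : ℂ).re) * (C * Real.exp (‖w + p‖ ^ 2 / 2)) := by
          rw [hg, norm_mul, Complex.norm_exp, Complex.neg_re]
          gcongr
          exact hC _
      _ = C * Real.exp (‖p‖ ^ 2 / 2) * Real.exp (‖z‖ ^ 2 / 2) *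
          Real.exp (‖t‖ ^ 2 * ‖q₀‖ ^ 2 / 2) := by
          rw [mul_left_comm, ← Real.exp_add, mul_assoc, mul_assoc, ← Real.exp_add, ← Real.exp_add,
            h2, h1]
          congr 2
          ring
      _ ≤ _ := by gcongr
  have h0 := eq_zero_of_fixed_translation hA hgd (mul_ne_zero hκ (Real.exp_ne_zero _)) hAq₀ hggrow
    hgeq (z - p)
  simp only [hg, sub_add_cancel] at h0
  exact (mul_eq_zero.1 h0).resolve_left (Complex.exp_ne_zero _)

end Uniqueness

/-! ### The reproducing kernel of the Fock space. -/

section Kernel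

open FockSpace

variable {d : ℕ}

theorem integral_exp_neg_norm_sq (d : ℕ) :
    ∫ z : EuclideanSpace ℂ (Fin d), Real.exp (-‖z‖ ^ 2) = Real.pi ^ d := by
  have h := GaussianFourier.integral_rexp_neg_mul_sq_norm (V := EuclideanSpace ℂ (Fin d)) one_pos
  have hr : Module.finrank ℝ (EuclideanSpace ℂ (Fin d)) = 2 * d := by
    rw [← Module.finrank_mul_finrank ℝ ℂ, Complex.finrank_real_complex, finrank_euclideanSpace_fin]
  rw [hr] at h
  simpa using h

theorem integrable_exp_neg_norm_sq (d : ℕ) :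
    Integrable fun z : EuclideanSpace ℂ (Fin d) => Real.exp (-‖z‖ ^ 2) := by
  by_contra h
  have := integral_exp_neg_norm_sq d
  rw [integral_undef h] at this
  exact (pow_ne_zero d Real.pi_ne_zero) this.symm

theorem differentiable_inner_right (w : EuclideanSpace ℂ (Fin d)) :
    Differentiable ℂ (fun z => inner ℂ w z) :=
  (innerSL ℂ w).differentiable

/-- The Weyl-type translate of an element of the Fock space is in the Fock space. -/
theorem exp_mul_translate_mem (f : FockSpace d) (w : EuclideanSpace ℂ (Fin d)) :
    (fun z => Complex.exp (-inner ℂ w z) * f (z + w)) ∈ fockSubmodule d := by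
  refine ⟨?_, ?_⟩
  · have := f.differentiable
    have := differentiable_inner_right w
    fun_prop
  · refine ((f.integrable_sq.comp_add_right w).const_mul (Real.exp (‖w‖ ^ 2))).congr
      (Eventually.of_forall fun z => ?_)
    have h : ‖z + w‖ ^ 2 = ‖z‖ ^ 2 + 2 * (inner ℂ w z : ℂ).re + ‖w‖ ^ 2 := by
      rw [norm_add_sq (𝕜 := ℂ), ← inner_re_symm]
      rfl
    simp only [norm_mul, Complex.norm_exp, Complex.neg_re, mul_pow]
    rw [h, mul_left_comm, ← Real.exp_add, mul_right_comm, mul_comm, ← Real.exp_nat_mul,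
      ← Real.exp_add]
    congr 2
    push_cast
    ring

theorem exp_inner_mem (w : EuclideanSpace ℂ (Fin d)) :
    (fun z => Complex.exp (inner ℂ w z)) ∈ fockSubmodule d := by
  have h1 : (fun _ => 1) ∈ fockSubmodule d :=
    ⟨differentiable_const _, by simpa [GaussSqIntegrable] using integrable_exp_neg_norm_sq d⟩
  simpa using exp_mul_translate_mem (mk _ h1) (-w)

/-- The reproducing kernel `z ↦ exp ⟨z, w⟩` of the Fock space. -/
noncomputable def fockKernel (w : EuclideanSpace ℂ (Fin d)) : FockSpace d :=
  mk _ (exp_inner_mem w)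

@[simp] theorem fockKernel_apply (w z : EuclideanSpace ℂ (Fin d)) :
    fockKernel w z = Complex.exp (inner ℂ w z) := rfl

/-- The Gaussian mean value property at the origin. -/
theorem integral_mul_exp_neg_norm_sq (f : FockSpace d) :
    ∫ z, f z * (Real.exp (-‖z‖ ^ 2) : ℂ) = (Real.pi : ℂ) ^ d * f 0 := by
  have h2pi : (0 : ℝ) ≤ 2 * Real.pi := by positivity
  have hfc := f.continuous
  have hcirc : Continuous (fun θ : ℝ => circleMap 0 1 θ) := continuous_circleMap 0 1
  have hint : Integrable fun z => f z * (Real.exp (-‖z‖ ^ 2) : ℂ) := by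
    simpa using integrable_mul (fockKernel 0) f
  -- The Gaussian is invariant under `z ↦ e^{iθ} z`, so by Fubini `f` may be replaced by its circle
  -- averages, all equal to `f 0`.
  have hmean : ∀ z, ∫ θ in (0 : ℝ)..2 * Real.pi, f (circleMap 0 1 θ • z) = 2 * Real.pi * f 0 := by
    intro z
    have hd : Differentiable ℂ (fun t : ℂ => f (t • z)) := by
      have := f.differentiable
      fun_prop
    have h := (hd.diffContOnCl (s := Metric.ball (0 : ℂ) |1|)).circleAverage
    simp only [zero_smul, Real.circleAverage] at h
    rw [← h, Complex.real_smul]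
    push_cast
    have : (Real.pi : ℂ) ≠ 0 := by exact_mod_cast Real.pi_ne_zero
    field_simp
  let e : ℝ → EuclideanSpace ℂ (Fin d) ≃ₗᵢ[ℝ] EuclideanSpace ℂ (Fin d) := fun θ =>
    { toLinearEquiv := (LinearEquiv.smulOfNeZero ℂ (EuclideanSpace ℂ (Fin d)) (circleMap 0 1 θ)
        (circleMap_ne_center one_ne_zero)).restrictScalars ℝ
      norm_map' := fun w => by
        change ‖circleMap 0 1 θ • w‖ = ‖w‖
        rw [norm_smul]
        simp }
  have he : ∀ θ w, e θ w = circleMap 0 1 θ • w := fun _ _ => rfl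
  have hn : ∀ (θ : ℝ) (z : EuclideanSpace ℂ (Fin d)), ‖circleMap 0 1 θ • z‖ = ‖z‖ := by
    intro θ z
    rw [norm_smul]
    simp
  have hrot : ∀ θ : ℝ, ∫ z, f (circleMap 0 1 θ • z) * (Real.exp (-‖z‖ ^ 2) : ℂ) =
      ∫ z, f z * (Real.exp (-‖z‖ ^ 2) : ℂ) := by
    intro θ
    have := (e θ).measurePreserving.integral_comp (e θ).toHomeomorph.measurableEmbedding
      (fun z => f z * (Real.exp (-‖z‖ ^ 2) : ℂ))
    simpa only [he, hn] using this
  have hjc : Continuous (fun p : ℝ × EuclideanSpace ℂ (Fin d) =>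
      f (circleMap 0 1 p.1 • p.2) * (Real.exp (-‖p.2‖ ^ 2) : ℂ)) := by
    fun_prop
  have hprod : Integrable (fun p : ℝ × EuclideanSpace ℂ (Fin d) =>
      f (circleMap 0 1 p.1 • p.2) * (Real.exp (-‖p.2‖ ^ 2) : ℂ))
      ((volume.restrict (Set.Ioc 0 (2 * Real.pi))).prod volume) := by
    rw [integrable_prod_iff hjc.aestronglyMeasurable]
    refine ⟨Eventually.of_forall fun θ => ?_, ?_⟩
    · have := (e θ).measurePreserving.integrable_comp_of_integrable hint
      simpa only [Function.comp_def, he, hn] using this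
    · have hnorm : ∀ θ : ℝ, ∫ z, ‖f (circleMap 0 1 θ • z) * (Real.exp (-‖z‖ ^ 2) : ℂ)‖ =
          ∫ z, ‖f z * (Real.exp (-‖z‖ ^ 2) : ℂ)‖ := by
        intro θ
        have := (e θ).measurePreserving.integral_comp (e θ).toHomeomorph.measurableEmbedding
          (fun z => ‖f z * (Real.exp (-‖z‖ ^ 2) : ℂ)‖)
        simpa only [he, hn] using this
      simp only [hnorm]
      exact integrable_const _
  have hswap := integral_integral_swap (f := fun (θ : ℝ) z =>
    f (circleMap 0 1 θ • z) * (Real.exp (-‖z‖ ^ 2) : ℂ)) hprod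
  simp only [hrot, ← intervalIntegral.integral_of_le h2pi,
    intervalIntegral.integral_mul_const, hmean] at hswap
  rw [integral_const_mul, integral_complex_ofReal, integral_exp_neg_norm_sq,
    intervalIntegral.integral_const, sub_zero, Complex.real_smul] at hswap
  have : (Real.pi : ℂ) ≠ 0 := by exact_mod_cast Real.pi_ne_zero
  simp only [Complex.ofReal_mul, Complex.ofReal_ofNat, Complex.ofReal_pow] at hswap
  refine mul_left_cancel₀ (mul_ne_zero two_ne_zero this) ?_
  linear_combination hswap

theorem ofReal_norm_sq_eq_inner (x : EuclideanSpace ℂ (Fin d)) :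
    ((‖x‖ ^ 2 : ℝ) : ℂ) = inner ℂ x x := by
  rw [inner_self_eq_norm_sq_to_K]
  exact Complex.ofReal_pow _ _

/-- The Gaussian mean value property at `0` for the Weyl translate of `f`, followed by the
substitution `z ↦ z + w`. -/
theorem inner_fockKernel (w : EuclideanSpace ℂ (Fin d)) (f : FockSpace d) :
    inner ℂ (fockKernel w) f = f w := by
  have h0 := integral_mul_exp_neg_norm_sq (mk _ (exp_mul_translate_mem f w))
  simp only [mk_apply, inner_zero_right, neg_zero, Complex.exp_zero, one_mul, zero_add] at h0
  have hpi : ((Real.pi : ℂ) ^ d) ≠ 0 := pow_ne_zero _ (by exact_mod_cast Real.pi_ne_zero)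
  rw [inner_def, inv_mul_eq_iff_eq_mul₀ hpi, ← h0, ← integral_add_right_eq_self _ w]
  congr 1
  funext z
  have h1 : (starRingEnd ℂ) (inner ℂ w (z + w)) + ((-‖z + w‖ ^ 2 : ℝ) : ℂ) =
      -inner ℂ w z + ((-‖z‖ ^ 2 : ℝ) : ℂ) := by
    rw [Complex.ofReal_neg, Complex.ofReal_neg, ofReal_norm_sq_eq_inner, ofReal_norm_sq_eq_inner,
      inner_conj_symm, inner_add_left, inner_add_left, inner_add_right, inner_add_right]
    ring
  rw [fockKernel_apply, ← Complex.exp_conj, Complex.ofReal_exp, Complex.ofReal_exp, mul_right_comm,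
    ← Complex.exp_add, h1, Complex.exp_add]
  ring

theorem norm_fockKernel (w : EuclideanSpace ℂ (Fin d)) :
    ‖fockKernel w‖ = Real.exp (‖w‖ ^ 2 / 2) := by
  have h : ((‖fockKernel w‖ ^ 2 : ℝ) : ℂ) = ((Real.exp (‖w‖ ^ 2) : ℝ) : ℂ) := by
    rw [Complex.ofReal_exp, ofReal_norm_sq_eq_inner, ← fockKernel_apply, ← inner_fockKernel,
      Complex.ofReal_pow]
    exact (inner_self_eq_norm_sq_to_K (𝕜 := ℂ) (fockKernel w)).symm
  have h2 : ‖fockKernel w‖ ^ 2 = Real.exp (‖w‖ ^ 2) := Complex.ofReal_injective h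
  have h3 : Real.exp (‖w‖ ^ 2) = Real.exp (‖w‖ ^ 2 / 2) ^ 2 := by
    rw [← Real.exp_nat_mul]
    congr 1
    push_cast
    ring
  rw [h3] at h2
  exact (pow_left_inj₀ (norm_nonneg _) (Real.exp_nonneg _) two_ne_zero).1 h2

/-- Supplies the sharp Gaussian growth required by `eq_zero_of_imaginary_eigenvalue`. -/
theorem norm_apply_le (f : FockSpace d) (z : EuclideanSpace ℂ (Fin d)) :
    ‖f z‖ ≤ ‖f‖ * Real.exp (‖z‖ ^ 2 / 2) := by
  rw [← inner_fockKernel, ← norm_fockKernel, mul_comm]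
  exact norm_inner_le_norm _ _

theorem dense_of_fockKernel_mem {D : Submodule ℂ (FockSpace d)} (h : ∀ w, fockKernel w ∈ D) :
    Dense (D : Set (FockSpace d)) := by
  rw [Submodule.dense_iff_topologicalClosure_eq_top, Submodule.topologicalClosure_eq_top_iff,
    Submodule.eq_bot_iff]
  intro f hf
  refine coe_ext fun w => ?_
  rw [← inner_fockKernel, zero_apply]
  exact (Submodule.mem_orthogonal _ _).1 hf _ (h w)

end Kernel

/-! ### Graphs of operators and adjoints. -/

section SelfAdjoint

open FockSpace

variable {d : ℕ} {ψ : EuclideanSpace ℂ (Fin d) → ℂ}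
  {φ : EuclideanSpace ℂ (Fin d) → EuclideanSpace ℂ (Fin d)}

@[simp] theorem maxWeightedComp_apply (f : (maxWeightedComp ψ φ).domain) (z) :
    maxWeightedComp ψ φ f z = ψ z * (f : FockSpace d) (φ z) := rfl

/-- Maximality of the domain makes the graph a purely pointwise condition. -/
theorem mem_maxWeightedComp_graph {f g : FockSpace d} :
    (f, g) ∈ (maxWeightedComp ψ φ).graph ↔ ∀ z, g z = ψ z * f (φ z) := by
  rw [LinearPMap.mem_graph_iff]
  constructor
  · rintro ⟨y, hy, hg⟩ z
    dsimp only at hy hg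
    rw [← hg, maxWeightedComp_apply, hy]
  · intro h
    have he : weightedComp ψ φ f = g := funext fun z => (h z).symm
    have hf : weightedComp ψ φ f ∈ fockSubmodule d := he ▸ g.coe_mem
    exact ⟨⟨f, hf⟩, rfl, coe_ext fun z => (h z).symm⟩

/-- `T` is densely defined and `T = ε T*`, expressed through the graph of `T`. -/
def IsTwistedSelfAdjoint (ε : ℝ) (T : FockSpace d →ₗ.[ℂ] FockSpace d) : Prop :=
  Dense (T.domain : Set (FockSpace d)) ∧
    ∀ f g, (f, g) ∈ T.graph ↔ ∀ x : T.domain, inner ℂ g (x : FockSpace d) = ε * inner ℂ f (T x)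

theorem mem_adjoint_graph {T : FockSpace d →ₗ.[ℂ] FockSpace d}
    (hT : Dense (T.domain : Set (FockSpace d))) {f g : FockSpace d} :
    (f, g) ∈ T†.graph ↔ ∀ x : T.domain, inner ℂ g (x : FockSpace d) = inner ℂ f (T x) := by
  rw [LinearPMap.mem_graph_iff]
  constructor
  · rintro ⟨y, hy, hg⟩ x
    dsimp only at hy hg
    rw [← hg, ← hy]
    exact T.adjoint_isFormalAdjoint hT y x
  · intro h
    exact ⟨⟨f, T.mem_adjoint_domain_of_exists f ⟨g, h⟩⟩, rfl, LinearPMap.adjoint_apply_eq hT _ h⟩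

theorem isRealSymmetric_iff {T : FockSpace d →ₗ.[ℂ] FockSpace d} :
    IsRealSymmetric T ↔ IsTwistedSelfAdjoint 1 T := by
  refine and_congr_right fun hT => ?_
  simp only [Complex.ofReal_one, one_mul, ← mem_adjoint_graph hT]
  constructor
  · intro h f g
    rw [← h]
  · intro h
    exact LinearPMap.eq_of_eq_graph (SetLike.ext fun x => h x.1 x.2)

theorem isSkewRealSymmetric_iff {T : FockSpace d →ₗ.[ℂ] FockSpace d} :
    IsSkewRealSymmetric T ↔ IsTwistedSelfAdjoint (-1) T := by
  refine and_congr_right fun hT => ?_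
  have key : ∀ f g : FockSpace d, (f, g) ∈ (-T†).graph ↔
      ∀ x : T.domain, inner ℂ g (x : FockSpace d) = ((-1 : ℝ) : ℂ) * inner ℂ f (T x) := by
    intro f g
    have h1 : (f, g) ∈ (-T†).graph ↔ (f, -g) ∈ T†.graph := by
      simp only [LinearPMap.mem_graph_iff, LinearPMap.neg_apply, neg_eq_iff_eq_neg]
      rfl
    rw [h1, mem_adjoint_graph hT]
    refine forall_congr' fun x => ?_
    rw [inner_neg_left, neg_eq_iff_eq_neg]
    simp
  simp only [← key]
  constructor
  · intro h f g
    rw [← h]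
  · intro h
    exact LinearPMap.eq_of_eq_graph (SetLike.ext fun x => h x.1 x.2)

/-- Taking adjoints reverses inclusions: `T ⊆ S` gives `S = ε S* ⊆ ε T* = T`. -/
theorem IsTwistedSelfAdjoint.eq_of_le {ε : ℝ} {S T : FockSpace d →ₗ.[ℂ] FockSpace d}
    (hS : IsTwistedSelfAdjoint ε S) (hT : IsTwistedSelfAdjoint ε T) (h : T ≤ S) : T = S := by
  refine h.antisymm (LinearPMap.le_of_le_graph fun x hx => ?_)
  rw [← Prod.mk.eta (p := x), hT.2]
  intro y
  have h1 := (hS.2 x.1 x.2).1 hx ⟨y, h.1 y.2⟩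
  rw [h.2 (x := y) (y := ⟨y, h.1 y.2⟩) rfl]
  exact h1

/-! ### Hermitian symbols give `S = ε S*`. -/

section Sufficiency

variable {A : EuclideanSpace ℂ (Fin d) →ₗ[ℂ] EuclideanSpace ℂ (Fin d)}
  {q : EuclideanSpace ℂ (Fin d)} {θ : ℂ} {ε : ℝ}

/-- Every vector splits along the orthogonal complement of a set. -/
theorem exists_add_orthogonal {H : Type*} [NormedAddCommGroup H] [InnerProductSpace ℂ H]
    [CompleteSpace H] (N : Set H) (x : H) :
    ∃ p ∈ (Submodule.span ℂ N)ᗮ, ∃ o ∈ (Submodule.span ℂ N)ᗮᗮ, x = p + o :=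
  Submodule.exists_add_mem_mem_orthogonal x

theorem kernel_mem_graph (hA : A.IsSymmetric) (hψ : ∀ z, ψ z = θ * Complex.exp (inner ℂ q z))
    (hφ : ∀ z, φ z = A z + q) (w : EuclideanSpace ℂ (Fin d)) :
    (fockKernel w, (θ * Complex.exp (inner ℂ w q)) • fockKernel (φ w)) ∈
      (maxWeightedComp ψ φ).graph := by
  rw [mem_maxWeightedComp_graph]
  intro z
  rw [smul_apply, fockKernel_apply, fockKernel_apply, hψ, hφ, hφ, mul_assoc, mul_assoc,
    ← Complex.exp_add, ← Complex.exp_add, inner_add_left, inner_add_right, hA]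
  congr 2
  ring

theorem inner_kernel_image (hε : starRingEnd ℂ θ = ε * θ)
    (hψ : ∀ z, ψ z = θ * Complex.exp (inner ℂ q z)) (w : EuclideanSpace ℂ (Fin d))
    (f : FockSpace d) :
    inner ℂ ((θ * Complex.exp (inner ℂ w q)) • fockKernel (φ w)) f = ε * (ψ w * f (φ w)) := by
  rw [inner_smul_left, inner_fockKernel, map_mul, hε, ← Complex.exp_conj, inner_conj_symm, hψ]
  ring

/-- The square of the operator does not have the eigenvalue `-ε`. -/
theorem eq_zero_of_sq_eigen (hA : A.IsSymmetric) (hθ : θ ≠ 0) (hε : starRingEnd ℂ θ = ε * θ)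
    (hψ : ∀ z, ψ z = θ * Complex.exp (inner ℂ q z)) (hφ : ∀ z, φ z = A z + q)
    {h k : FockSpace d} (hk : ∀ z, k z = ψ z * h (φ z))
    (hh : ∀ z, h z + ε * (ψ z * k (φ z)) = 0) : h = 0 := by
  set m : ℝ := ‖θ‖ with hm
  have hm0 : m ≠ 0 := norm_ne_zero_iff.2 hθ
  have hmc : (m : ℂ) ≠ 0 := by exact_mod_cast hm0
  have hm2 : (ε : ℂ) * θ * θ = m ^ 2 := by
    rw [← hε, mul_comm, Complex.mul_conj, Complex.normSq_eq_norm_sq]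
    push_cast
    rfl
  -- With `W f = exp ⟨z, q⟩ · (f ∘ φ)`, the function below is `m (W + s i/m) h`. Since `W² h = -h /
  -- m²`, it satisfies the eigenvalue equation of `W` for `i s / m`. Subtracting the cases `s = ±1`
  -- isolates `h`.
  have key : ∀ s : ℝ, s * s = 1 → ∀ z, m / θ * k z + s * Complex.I * h z = 0 := by
    intro s hs z
    have hsc : (s : ℂ) * s = 1 := by exact_mod_cast hs
    have hs0 : s ≠ 0 := fun h => by simp [h] at hs
    set u : FockSpace d := (m / θ) • k + (s * Complex.I) • h with hu
    have := eq_zero_of_imaginary_eigenvalue hA u.differentiable (q := q) (κ := s / m)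
      (div_ne_zero hs0 hm0) (norm_apply_le u) (fun x => ?_) z
    · simpa [hu] using this
    · have h1 := hk x
      have h2 := hh x
      rw [hψ, hφ] at h1 h2
      simp only [hu, add_apply, smul_apply]
      set a := Complex.exp (inner ℂ q x)
      have h3 : a * h (A x + q) = k x / θ := by rw [h1]; field_simp
      have h4 : a * k (A x + q) = -(θ * h x) / m ^ 2 := by
        rw [← hm2, eq_div_iff (by rw [hm2]; exact pow_ne_zero 2 hmc)]
        linear_combination θ * h2
      calc _ = m / θ * (a * k (A x + q)) + s * Complex.I * (a * h (A x + q)) := by ring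
        _ = -(h x) / m + s * Complex.I * k x / θ := by
          rw [h3, h4]
          field_simp
        _ = _ := by
          push_cast
          field_simp
          linear_combination (-(h x) * θ) * hsc * Complex.I ^ 2 - h x * θ * (Complex.I_sq)
  refine coe_ext fun z => ?_
  have h1 := key 1 (by norm_num) z
  have h2 := key (-1) (by norm_num) z
  have h3 : Complex.I * h z = 0 := by
    push_cast at h1 h2
    linear_combination (h1 - h2) / 2
  simpa using h3

/-- The maximal operator of Hermitian form coincides with `ε` times its adjoint. -/
theorem isTwistedSelfAdjoint_maxWeightedComp (hA : A.IsSymmetric) (hθ : θ ≠ 0)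
    (hε : starRingEnd ℂ θ = ε * θ) (hε1 : ε * ε = 1)
    (hψ : ∀ z, ψ z = θ * Complex.exp (inner ℂ q z)) (hφ : ∀ z, φ z = A z + q) :
    IsTwistedSelfAdjoint ε (maxWeightedComp ψ φ) := by
  set S := maxWeightedComp ψ φ with hS
  have hεc : (ε : ℂ) * ε = 1 := by exact_mod_cast hε1
  have hker := kernel_mem_graph hA hψ hφ
  -- The inclusion `ε S* ⊆ S`: testing against `x = K_w` yields the value of `g` at `w`.
  have hadj : ∀ f g : FockSpace d, (∀ x : S.domain, inner ℂ g (x : FockSpace d) =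
      ε * inner ℂ f (S x)) → (f, g) ∈ S.graph := by
    intro f g h
    rw [hS, mem_maxWeightedComp_graph]
    intro w
    obtain ⟨y, hy, hSy⟩ := (LinearPMap.mem_graph_iff S).1 (hker w)
    dsimp only at hy hSy
    have h1 := congrArg (starRingEnd ℂ) (h y)
    rw [map_mul, inner_conj_symm, inner_conj_symm, hy, hSy, inner_fockKernel,
      inner_kernel_image hε hψ, Complex.conj_ofReal, ← mul_assoc, hεc, one_mul] at h1
    exact h1
  refine ⟨dense_of_fockKernel_mem fun w => LinearPMap.mem_domain_of_mem_graph (hker w),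
    fun f g => ⟨fun hfg => ?_, hadj f g⟩⟩
  -- The flipped graph of `S`, with the sign chosen so that its orthogonal complement is the graph
  -- of `ε S*`.
  let N : Set (WithLp 2 (FockSpace d × FockSpace d)) :=
    Set.range fun x : S.domain => WithLp.toLp 2 (-(ε : ℂ) • S x, (x : FockSpace d))
  have hM : ∀ p, p ∈ (Submodule.span ℂ N)ᗮ ↔
      ∀ x : S.domain, inner ℂ p.snd (x : FockSpace d) = ε * inner ℂ p.fst (S x) := by
    intro p
    rw [Submodule.mem_orthogonal']
    have h1 : (∀ u ∈ Submodule.span ℂ N, inner ℂ p u = 0) ↔ ∀ u ∈ N, inner ℂ p u = 0 := by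
      refine ⟨fun h u hu => h u (Submodule.subset_span hu), fun h u hu => ?_⟩
      induction hu using Submodule.span_induction with
      | mem u hu => exact h u hu
      | zero => exact inner_zero_right _
      | add u v _ _ hu hv => rw [inner_add_right, hu, hv, add_zero]
      | smul c u _ hu => rw [inner_smul_right, hu, mul_zero]
    rw [h1, Set.forall_mem_range]
    refine forall_congr' fun x => ?_
    rw [WithLp.prod_inner_apply]
    dsimp only
    rw [inner_smul_right, neg_mul, neg_add_eq_zero, eq_comm]
    rfl
  obtain ⟨p, hp, o, ho, hpo⟩ := exists_add_orthogonal N (WithLp.toLp 2 (f, g))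
  have hpS := hadj _ _ ((hM p).1 hp)
  have ho1 : o.fst = f - p.fst := by
    rw [eq_sub_iff_add_eq', ← WithLp.add_fst, ← hpo]
    rfl
  have ho2 : o.snd = g - p.snd := by
    rw [eq_sub_iff_add_eq', ← WithLp.add_snd, ← hpo]
    rfl
  have hoS : (o.fst, o.snd) ∈ S.graph := by
    rw [ho1, ho2]
    exact S.graph.sub_mem hfg hpS
  rw [hS, mem_maxWeightedComp_graph] at hoS
  -- The kernel pairs `(K_w, S K_w)` also lie in the graph of `ε S*`; orthogonality of `o` to them
  -- is this identity.
  have hsq : ∀ w, o.fst w + ε * (ψ w * o.snd (φ w)) = 0 := by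
    intro w
    have hw : WithLp.toLp 2 (fockKernel w, (θ * Complex.exp (inner ℂ w q)) • fockKernel (φ w)) ∈
        (Submodule.span ℂ N)ᗮ := by
      rw [hM]
      intro x
      change inner ℂ ((θ * Complex.exp (inner ℂ w q)) • fockKernel (φ w)) (x : FockSpace d) =
        ε * inner ℂ (fockKernel w) (S x)
      rw [inner_kernel_image hε hψ, inner_fockKernel]
      rfl
    have h1 := (Submodule.mem_orthogonal _ _).1 ho _ hw
    rw [WithLp.prod_inner_apply] at h1
    dsimp only at h1
    rwa [inner_kernel_image hε hψ, inner_fockKernel] at h1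
  have h0 := eq_zero_of_sq_eigen hA hθ hε hψ hφ hoS hsq
  have h0' : o.snd = 0 := coe_ext fun z => by rw [hoS, h0]; simp
  rw [ho1, sub_eq_zero] at h0
  rw [ho2, sub_eq_zero] at h0'
  rw [h0, h0']
  exact (hM p).1 hp

end Sufficiency

/-! ### `T = ε T*` forces Hermitian symbols. -/

/-- Differentiating `exp H = 1` gives `H' = 0`; no choice of logarithm is needed. -/
theorem eq_of_exp_eq_one {H : EuclideanSpace ℂ (Fin d) → ℂ} (hH : Differentiable ℂ H)
    (h : ∀ z, Complex.exp (H z) = 1) (z w : EuclideanSpace ℂ (Fin d)) : H z = H w := by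
  refine is_const_of_fderiv_eq_zero hH (fun x => ?_) z w
  have h1 := (hH x).hasFDerivAt.cexp
  have h2 : (fun x => Complex.exp (H x)) = fun _ => 1 := funext h
  rw [h2, h x, one_smul] at h1
  exact h1.unique (hasFDerivAt_const 1 x)

/-- The symbols of a weighted composition operator that coincides with `ε` times its adjoint. -/
theorem hasHermitianForm_of_isTwistedSelfAdjoint (hψ0 : ψ ≠ 0) (hφ : Differentiable ℂ φ) {ε : ℝ}
    (hε1 : ε * ε = 1) {T : FockSpace d →ₗ.[ℂ] FockSpace d} (hT : T ≤ maxWeightedComp ψ φ)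
    (h : IsTwistedSelfAdjoint ε T) :
    HasHermitianForm {θ | starRingEnd ℂ θ = ε * θ} ψ φ := by
  have hεc : (ε : ℂ) * ε = 1 := by exact_mod_cast hε1
  have hfun : ∀ w z, ψ z * Complex.exp (inner ℂ w (φ z)) =
      ε * starRingEnd ℂ (ψ w) * Complex.exp (inner ℂ (φ w) z) := by
    intro w z
    -- The pair lies in the graph of `ε T*` by the reproducing property, hence in that of `T`,
    -- however small the domain of `T` was allowed to be.
    have h1 : (fockKernel w, (ε * starRingEnd ℂ (ψ w)) • fockKernel (φ w)) ∈ T.graph := by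
      rw [h.2]
      intro x
      rw [inner_smul_left, inner_fockKernel, inner_fockKernel,
        hT.2 (x := x) (y := ⟨x, hT.1 x.2⟩) rfl, maxWeightedComp_apply]
      simp
      ring
    have h2 := mem_maxWeightedComp_graph.1 (LinearPMap.le_graph_of_le hT h1) z
    rw [smul_apply, fockKernel_apply, fockKernel_apply] at h2
    exact h2.symm
  set q := φ 0 with hq
  have h00 : ψ 0 = ε * starRingEnd ℂ (ψ 0) := by simpa using hfun 0 0
  have hψ : ∀ z, ψ z = ψ 0 * Complex.exp (inner ℂ q z) := by
    intro z
    have := hfun 0 z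
    rw [← h00] at this
    simpa using this
  have hθ : ψ 0 ≠ 0 := fun h0 => hψ0 (funext fun z => by rw [hψ, h0, zero_mul]; rfl)
  -- After cancelling `ψ 0`, the two exponents differ by an `H` with `exp H = 1`; it is constant in
  -- `z` and vanishes at `z = 0`.
  have hsymm : ∀ w z, inner ℂ w (φ z - q) = inner ℂ (φ w - q) z := by
    intro w z
    have h1 := eq_of_exp_eq_one
      (H := fun z => inner ℂ q z + inner ℂ w (φ z) - inner ℂ w q - inner ℂ (φ w) z) ?_ ?_ z 0
    · simp only [inner_zero_right, ← hq] at h1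
      rw [inner_sub_left, inner_sub_right]
      linear_combination h1
    · have h1 := differentiable_inner_right q
      have h2 := differentiable_inner_right (φ w)
      have h3 := (differentiable_inner_right w).comp hφ
      exact ((h1.add h3).sub_const _).sub h2
    · intro x
      have h1 := hfun w x
      rw [hψ w, hψ x, map_mul, ← mul_assoc, ← h00, mul_assoc, mul_assoc, ← Complex.exp_conj,
        inner_conj_symm, ← Complex.exp_add, ← Complex.exp_add] at h1
      rw [sub_sub, Complex.exp_sub, mul_left_cancel₀ hθ h1, div_self (Complex.exp_ne_zero _)]
  -- A map with a formal adjoint is linear: `hsymm` moves it to the other side of the inner product.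
  let A : EuclideanSpace ℂ (Fin d) →ₗ[ℂ] EuclideanSpace ℂ (Fin d) :=
    { toFun := fun z => φ z - q
      map_add' := fun x y => ext_inner_left ℂ fun w => by
        rw [hsymm, inner_add_right, inner_add_right, hsymm, hsymm]
      map_smul' := fun c x => ext_inner_left ℂ fun w => by
        rw [hsymm, inner_smul_right, RingHom.id_apply, inner_smul_right, hsymm] }
  have hAs : A.IsSymmetric := fun w z => (hsymm w z).symm
  refine ⟨Matrix.toEuclideanLin.symm A, q, ψ 0, ?_, ?_, hψ, fun z => ?_⟩
  · rw [← Matrix.isSymmetric_toEuclideanLin_iff, LinearEquiv.apply_symm_apply]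
    exact hAs
  · change starRingEnd ℂ (ψ 0) = ε * ψ 0
    conv_rhs => rw [h00]
    rw [← mul_assoc, hεc, one_mul]
  · rw [LinearEquiv.apply_symm_apply]
    exact (sub_add_cancel _ _).symm

/-! ### Both directions combined; `ε = 1` and `ε = -1`. -/

theorem isTwistedSelfAdjoint_of_hasHermitianForm (hψ0 : ψ ≠ 0) {ε : ℝ} (hε1 : ε * ε = 1)
    (h : HasHermitianForm {θ | starRingEnd ℂ θ = ε * θ} ψ φ) :
    IsTwistedSelfAdjoint ε (maxWeightedComp ψ φ) := by
  obtain ⟨Q, q, θ, hQ, hθ, hψ, hφ⟩ := h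
  refine isTwistedSelfAdjoint_maxWeightedComp (Matrix.isSymmetric_toEuclideanLin_iff.2 hQ) ?_ hθ
    hε1 hψ hφ
  rintro rfl
  exact hψ0 (funext fun z => by rw [hψ, zero_mul]; rfl)

theorem isTwistedSelfAdjoint_iff (hψ0 : ψ ≠ 0) (hφ : Differentiable ℂ φ) {ε : ℝ}
    (hε1 : ε * ε = 1) {T : FockSpace d →ₗ.[ℂ] FockSpace d} (hT : T ≤ maxWeightedComp ψ φ) :
    IsTwistedSelfAdjoint ε T ↔
      T = maxWeightedComp ψ φ ∧ HasHermitianForm {θ | starRingEnd ℂ θ = ε * θ} ψ φ := by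
  constructor
  · intro h
    have hF := hasHermitianForm_of_isTwistedSelfAdjoint hψ0 hφ hε1 hT h
    exact ⟨(isTwistedSelfAdjoint_of_hasHermitianForm hψ0 hε1 hF).eq_of_le h hT, hF⟩
  · rintro ⟨rfl, hF⟩
    exact isTwistedSelfAdjoint_of_hasHermitianForm hψ0 hε1 hF

theorem setOf_im_eq_zero : {θ : ℂ | θ.im = 0} = {θ | starRingEnd ℂ θ = ((1 : ℝ) : ℂ) * θ} := by
  ext θ
  simp [Complex.conj_eq_iff_im]

theorem setOf_re_eq_zero : {θ : ℂ | θ.re = 0} = {θ | starRingEnd ℂ θ = ((-1 : ℝ) : ℂ) * θ} := by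
  ext θ
  simp [Complex.ext_iff, eq_neg_iff_add_eq_zero]

end SelfAdjoint

theorem theorem1p1 (d : ℕ) (ψ : EuclideanSpace ℂ (Fin d) → ℂ)
    (φ : EuclideanSpace ℂ (Fin d) → EuclideanSpace ℂ (Fin d))
    (hψ : Differentiable ℂ ψ) (hψ0 : ψ ≠ 0) (hφ : Differentiable ℂ φ) :
    -- (a)
    ((IsRealSymmetric (maxWeightedComp ψ φ) ↔ HasHermitianForm {θ | θ.im = 0} ψ φ) ∧
      (IsSkewRealSymmetric (maxWeightedComp ψ φ) ↔ HasHermitianForm {θ | θ.re = 0} ψ φ)) ∧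
    -- (b)
    ∀ T : FockSpace d →ₗ.[ℂ] FockSpace d, IsWeightedComp ψ φ T →
      ((IsRealSymmetric T ↔
          T = maxWeightedComp ψ φ ∧ HasHermitianForm {θ | θ.im = 0} ψ φ) ∧
        (IsSkewRealSymmetric T ↔
          T = maxWeightedComp ψ φ ∧ HasHermitianForm {θ | θ.re = 0} ψ φ)) := by
  rw [setOf_im_eq_zero, setOf_re_eq_zero]
  simp only [isRealSymmetric_iff, isSkewRealSymmetric_iff]
  have h1 : (1 : ℝ) * 1 = 1 := by norm_num
  have h2 : (-1 : ℝ) * -1 = 1 := by norm_num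
  refine ⟨⟨?_, ?_⟩, fun T hT => ⟨isTwistedSelfAdjoint_iff hψ0 hφ h1 hT,
    isTwistedSelfAdjoint_iff hψ0 hφ h2 hT⟩⟩
  · simpa using isTwistedSelfAdjoint_iff hψ0 hφ h1 (le_refl (maxWeightedComp ψ φ))
  · exact (isTwistedSelfAdjoint_iff hψ0 hφ h2 le_rfl).trans (and_iff_right rfl)
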